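/- Let $A\in\mathbb R^{m\times N}$ and $f\in\mathbb R^m$ be arbitrary. For $t>0$ let $U_t:=\operatorname{argmin}_{u\in\mathbb R^N}\tfrac12\|Au-f\|_2^2+t\|u\|_1$, and let $U_0$ be the set of minimizers of $\|u\|_1$ subject to $A^T(Au-f)=0$ (the $\ell_1$-minimal least squares solutions). The generalized homotopy method with input $A,f$ is the following iteration. Start with $t^0=\|A^Tf\|_\infty$ and $u(t^0)=0$. For $j=0,1,\dots$: if $t^j=0$, stop and set $K=j$. Otherwise put $r^j=f-Au(t^j)$, $p^j=\frac1{t^j}A^Tr^j$, $\mathcal E^j=\{i: |A_i^Tr^j|=t^j\}$ ($A_i$ denoting the $i$-th column of $A$) and $\mathcal A^j=\{i: u(t^j)_i\neq0\}$; let $$D^j=\operatorname{argmin}_{d\in\mathbb R^N}\Big\{\big\|Ad-\tfrac1{t^j}r^j\big\|_2^2 : d_i=0\ \ \forall i\notin\mathcal E^j,\quad d_i\,p^j_i\ge0\ \ \forall i\in\mathcal E^j\setminus\mathcal A^j\Big\},$$ let $d^{j+1}$ be the element of $D^j$ of minimal $\ell_2$-norm, let $t^{j+1}\in[0,t^j]$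 be minimal such that $u(t^j)+(t^j-t)\,d^{j+1}\in U_t$ for all $t\in[t^{j+1},t^j]$, and set $u(t^{j+1})=u(t^j)+(t^j-t^{j+1})\,d^{j+1}$. Then for all $A$ and $f$ every step of this method is well defined (the required $d^{j+1}$ and $t^{j+1}$ exist and are unique), and the method terminates after finitely many iterations, producing parameters $t^0>t^1>\dots>t^K=0$ and vectors $u(t^0),\dots,u(t^K)$. Moreover, the path $u:\mathbb R_{\ge0}\to\mathbb R^N$ defined by $u(t)=0$ for $t\ge t^0$ and $$u(t)=\frac{t-t^k}{t^{k-1}-t^k}\,u(t^{k-1})+\frac{t^{k-1}-t}{t^{k-1}-t^k}\,u(t^k)\qquad\text{for } t\in[t^k,t^{k-1}),\ 1\le k\le K,$$ is piecewise linear (affine on each of finitely many intervals covering $[0,\infty)$) and continuous, and it satisfies $u(t)\in U_t$ for all $t>0$ as well as $u(0)\in U_0$. -/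

import Mathlib

open scoped Matrix NNReal

namespace Lasso

noncomputable section

/-- The set of minimizers of `g` over the feasible set `S`. -/
def argminOn {X : Type*} (g : X → ℝ) (S : Set X) : Set X :=
  {x | x ∈ S ∧ ∀ y ∈ S, g x ≤ g y}

/-- The squared Euclidean norm. -/
def l2sq {n : ℕ} (v : Fin n → ℝ) : ℝ := ∑ i, v i ^ 2

/-- The `ℓ₁`-norm. -/
def l1 {n : ℕ} (v : Fin n → ℝ) : ℝ := ∑ i, |v i|

variable {m N : ℕ} (A : Matrix (Fin m) (Fin N) ℝ) (f : Fin m → ℝ)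

/-- The energy `½ ‖A u - f‖₂² + t ‖u‖₁`. -/
def energy (t : ℝ) (u : Fin N → ℝ) : ℝ :=
  1 / 2 * l2sq (A *ᵥ u - f) + t * l1 u

/-- The solution set `U_t` for `t ≥ 0`: the minimizers of the energy if `t > 0`, and the
`ℓ₁`-minimal least squares solutions if `t = 0`. (Only `t ≥ 0` is ever used.) -/
def solutionSet (t : ℝ) : Set (Fin N → ℝ) :=
  {u | (0 < t → u ∈ argminOn (energy A f t) Set.univ) ∧
    (t = 0 → u ∈ argminOn l1 {v | Aᵀ *ᵥ (A *ᵥ v - f) = 0})}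

/-- The equicorrelation set `{i : |A_iᵀ (A u - f)| = t}`. -/
def equicorrelationSet (t : ℝ) (u : Fin N → ℝ) : Set (Fin N) :=
  {i | |(Aᵀ *ᵥ (A *ᵥ u - f)) i| = t}

/-- The active set, i.e. the support of `u`. -/
def activeSet (u : Fin N → ℝ) : Set (Fin N) := {i | u i ≠ 0}

/-- The vector `p = (1/t) Aᵀ (f - A u)`, used for `t > 0` only. -/
def subgrad (t : ℝ) (u : Fin N → ℝ) : Fin N → ℝ :=
  (1 / t) • (Aᵀ *ᵥ (f - A *ᵥ u))

/-- The solutions of the nonnegative least squares problem at `(t, u)`: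
minimize `‖A d - (1/t) (f - A u)‖₂²` over all `d` with `d i = 0` off the equicorrelation set and
`d i * p i ≥ 0` on the equicorrelation set minus the active set. -/
def directions (t : ℝ) (u : Fin N → ℝ) : Set (Fin N → ℝ) :=
  argminOn (fun d => l2sq (A *ᵥ d - (1 / t) • (f - A *ᵥ u)))
    {d | (∀ i, i ∉ equicorrelationSet A f t u → d i = 0) ∧
      ∀ i ∈ equicorrelationSet A f t u \ activeSet u, 0 ≤ d i * subgrad A f t u i}

/-- One iteration of the generalized homotopy method, from the iterate `(t, u)` to the iterate
`(t', u')` along the direction `d`. It is carried out only if `t ≠ 0`. The direction `d` has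
minimal Euclidean norm among the solutions of the nonnegative least squares problem, and `t'` is
the minimal parameter in `[0, t]` such that `u + (t - τ) d` solves the problem with parameter `τ`
for all `τ ∈ [t', t]`. -/
structure IsStep (t : ℝ) (u d : Fin N → ℝ) (t' : ℝ) (u' : Fin N → ℝ) : Prop where
  ne_zero : t ≠ 0
  direction : d ∈ argminOn l2sq (directions A f t u)
  parameter : IsLeast {s | 0 ≤ s ∧ s ≤ t ∧
    ∀ τ ∈ Set.Icc s t, u + (t - τ) • d ∈ solutionSet A f τ} t'
  iterate : u' = u + (t - t') • d

/-- `(t 0, u 0), …, (t n, u n)` are the first `n + 1` iterates of an execution of the generalized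
homotopy method with input `A`, `f`, and `d 1, …, d n` are the directions chosen on the way.
(`‖Aᵀ *ᵥ f‖` is the maximum norm.) -/
structure IsExecution (n : ℕ) (t : ℕ → ℝ) (u d : ℕ → Fin N → ℝ) : Prop where
  parameter_zero : t 0 = ‖Aᵀ *ᵥ f‖
  iterate_zero : u 0 = 0
  step : ∀ j < n, IsStep A f (t j) (u j) (d (j + 1)) (t (j + 1)) (u (j + 1))

/-- `w` is the linear interpolation of the points `(t 0, u 0), …, (t K, u K)`, where
`t 0 > … > t K = 0`, extended by `0` to `[t 0, ∞)`. -/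
def IsInterpolation (K : ℕ) (t : ℕ → ℝ) (u : ℕ → Fin N → ℝ) (w : ℝ≥0 → Fin N → ℝ) : Prop :=
  (∀ τ : ℝ≥0, t 0 ≤ τ → w τ = 0) ∧
  ∀ k < K, ∀ τ : ℝ≥0, (τ : ℝ) ∈ Set.Ico (t (k + 1)) (t k) →
    w τ = ((τ - t (k + 1)) / (t k - t (k + 1))) • u k
      + ((t k - τ) / (t k - t (k + 1))) • u (k + 1)

/-- `w` is piecewise linear: there are finitely many breakpoints `0 = s 0 < … < s n` such that
`w` is affine on each `[s i, s (i + 1))` and on `[s n, ∞)`. -/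
def IsPiecewiseLinear (w : ℝ≥0 → Fin N → ℝ) : Prop :=
  ∃ (n : ℕ) (s : Fin (n + 1) → ℝ≥0), s 0 = 0 ∧ StrictMono s ∧
    (∀ i : Fin n, ∃ a b : Fin N → ℝ,
      ∀ τ ∈ Set.Ico (s i.castSucc) (s i.succ), w τ = a + (τ : ℝ) • b) ∧
    ∃ a b : Fin N → ℝ, ∀ τ ∈ Set.Ici (s (Fin.last n)), w τ = a + (τ : ℝ) • b

end

end Lasso

namespace Lasso

/-! ### Optimality conditions and their stability under limits -/

section

variable {m N : ℕ} (A : Matrix (Fin m) (Fin N) ℝ) (f : Fin m → ℝ)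

/-! For `t > 0`, membership in `U_t` is the coordinatewise condition `IsKKT` on the correlations `Aᵀ
(f - A u)`, and all solutions at one `t` share the image `A u`. The optimality conditions of the
nonnegative least squares problem are exactly what keeps `IsKKT` true for a short time along `d`
(`IsKKT.exists_segment`), so every step has positive length. Limits of solutions are solutions, also
at `t = 0`, so the minimal parameter is attained.

Termination is the hard point. Inside a step, `d` remains the minimal-norm least squares solution
(`IsStep.direction_interior`), and it depends only on the pattern there: which correlations equal
`τ`, which equal `-τ`, and the active set (`SameSides.direction_eq`). There are finitely many
patterns, so an infinite run would repeat one, and hence a direction. By convexity the extreme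
correlations then keep their signs at all parameters in between (`SameSides.of_between`). While
these signs are constant, the norms of successive directions strictly increase (`IsStep.l2sq_lt`),
so no direction can recur. -/

theorem l2sq_eq_dotProduct {n : ℕ} (v : Fin n → ℝ) : l2sq v = v ⬝ᵥ v := by
  simp [l2sq, dotProduct, sq]

theorem l2sq_nonneg {n : ℕ} (v : Fin n → ℝ) : 0 ≤ l2sq v :=
  Finset.sum_nonneg fun _ _ => sq_nonneg _

theorem l2sq_eq_zero {n : ℕ} {v : Fin n → ℝ} : l2sq v = 0 ↔ v = 0 := by
  rw [l2sq_eq_dotProduct, dotProduct_self_eq_zero]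

theorem l2sq_add {n : ℕ} (v w : Fin n → ℝ) : l2sq (v + w) = l2sq v + 2 * (v ⬝ᵥ w) + l2sq w := by
  simp only [l2sq_eq_dotProduct, add_dotProduct, dotProduct_add]
  rw [dotProduct_comm w v]; ring

theorem l2sq_smul {n : ℕ} (c : ℝ) (v : Fin n → ℝ) : l2sq (c • v) = c ^ 2 * l2sq v := by
  simp only [l2sq_eq_dotProduct, smul_dotProduct, dotProduct_smul, smul_eq_mul]; ring

theorem continuous_l2sq {n : ℕ} : Continuous (l2sq : (Fin n → ℝ) → ℝ) := by
  unfold l2sq; fun_prop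

theorem continuous_l1 {n : ℕ} : Continuous (l1 : (Fin n → ℝ) → ℝ) := by
  unfold l1; fun_prop

theorem mulVec_dotProduct_eq (x : Fin N → ℝ) (y : Fin m → ℝ) :
    (A *ᵥ x) ⬝ᵥ y = x ⬝ᵥ (Aᵀ *ᵥ y) := by
  rw [Matrix.mulVec_transpose, dotProduct_comm, Matrix.dotProduct_mulVec, dotProduct_comm]

theorem l2sq_mulVec (x : Fin N → ℝ) : l2sq (A *ᵥ x) = x ⬝ᵥ (Aᵀ *ᵥ (A *ᵥ x)) := by
  rw [l2sq_eq_dotProduct, mulVec_dotProduct_eq]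

/-- The correlations `Aᵀ (f - A u)` of the columns of `A` with the residual. -/
def corr (u : Fin N → ℝ) : Fin N → ℝ := Aᵀ *ᵥ (f - A *ᵥ u)

theorem corr_add (u d : Fin N → ℝ) : corr A f (u + d) = corr A f u - Aᵀ *ᵥ (A *ᵥ d) := by
  simp only [corr, Matrix.mulVec_add, Matrix.mulVec_sub]; abel

theorem corr_add_smul (u d : Fin N → ℝ) (h : ℝ) (i : Fin N) :
    corr A f (u + h • d) i = corr A f u i - h * (Aᵀ *ᵥ (A *ᵥ d)) i := by
  simp [corr_add, Matrix.mulVec_smul]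

theorem corr_neg_eq (u : Fin N → ℝ) : Aᵀ *ᵥ (A *ᵥ u - f) = -corr A f u := by
  rw [corr, ← Matrix.mulVec_neg, neg_sub]

theorem continuous_corr : Continuous (corr A f) := by
  unfold corr; fun_prop

theorem corr_congr {u v : Fin N → ℝ} (h : A *ᵥ u = A *ᵥ v) : corr A f u = corr A f v := by
  rw [corr, h, corr]

theorem mem_equicorrelationSet {t : ℝ} {u : Fin N → ℝ} {i : Fin N} :
    i ∈ equicorrelationSet A f t u ↔ |corr A f u i| = t := by
  simp [equicorrelationSet, corr_neg_eq]

theorem subgrad_apply (t : ℝ) (u : Fin N → ℝ) (i : Fin N) :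
    subgrad A f t u i = corr A f u i / t := by
  simp [subgrad, corr]; ring

/-- The optimality conditions of the problem with parameter `t`. -/
def IsKKT (t : ℝ) (u : Fin N → ℝ) : Prop :=
  ∀ i, |corr A f u i| ≤ t ∧ (0 < u i → corr A f u i = t) ∧ (u i < 0 → corr A f u i = -t)

/-- The quadratic part has an exact second-order expansion with gradient `-corr A f u`; both
directions of the optimality criterion are read off from it. -/
theorem energy_expand (t : ℝ) (u v : Fin N → ℝ) :
    energy A f t v = energy A f t u + 1 / 2 * l2sq (A *ᵥ (v - u)) - (v - u) ⬝ᵥ corr A f u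
      + t * (l1 v - l1 u) := by
  have h : A *ᵥ v - f = A *ᵥ (v - u) + (A *ᵥ u - f) := by
    rw [Matrix.mulVec_sub]; abel
  rw [energy, energy, h, l2sq_add, mulVec_dotProduct_eq, corr_neg_eq, dotProduct_neg]
  ring

variable {A f}

theorem IsKKT.dotProduct_self {t : ℝ} {u : Fin N → ℝ} (h : IsKKT A f t u) :
    u ⬝ᵥ corr A f u = t * l1 u := by
  rw [l1, Finset.mul_sum]
  refine Finset.sum_congr rfl fun i _ => ?_
  obtain ⟨-, h2, h3⟩ := h i
  rcases lt_trichotomy (u i) 0 with hi | hi | hi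
  · rw [h3 hi, abs_of_neg hi]; ring
  · simp [hi]
  · rw [h2 hi, abs_of_pos hi]; ring

theorem IsKKT.dotProduct_le {t : ℝ} {u : Fin N → ℝ} (h : IsKKT A f t u) (v : Fin N → ℝ) :
    v ⬝ᵥ corr A f u ≤ t * l1 v := by
  rw [l1, Finset.mul_sum]
  refine Finset.sum_le_sum fun i _ => ?_
  calc v i * corr A f u i ≤ |v i| * |corr A f u i| := by rw [← abs_mul]; exact le_abs_self _
    _ ≤ |v i| * t := mul_le_mul_of_nonneg_left (h i).1 (abs_nonneg _)
    _ = t * |v i| := mul_comm _ _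

theorem IsKKT.mem_argminOn {t : ℝ} {u : Fin N → ℝ} (h : IsKKT A f t u) :
    u ∈ argminOn (energy A f t) Set.univ := by
  refine ⟨trivial, fun v _ => ?_⟩
  have h1 := h.dotProduct_self
  have h2 := h.dotProduct_le v
  have h3 := l2sq_nonneg (A *ᵥ (v - u))
  rw [energy_expand A f t u v, sub_dotProduct]
  linarith

theorem l1_add_single (u : Fin N → ℝ) (i : Fin N) (e : ℝ) :
    l1 (u + Pi.single i e) - l1 u = |u i + e| - |u i| := by
  rw [l1, l1, ← Finset.sum_sub_distrib, Finset.sum_eq_single i]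
  · simp
  · intro j _ hj; simp [hj]
  · simp

theorem mulVec_single_eq_smul (i : Fin N) (e : ℝ) :
    A *ᵥ Pi.single i e = e • (A *ᵥ Pi.single i 1) := by
  rw [← Matrix.mulVec_smul, ← Pi.single_smul]; simp

/-- A quantity that is at most every small positive multiple of `c` is nonpositive. -/
theorem nonpos_of_forall_le_mul {x c δ : ℝ} (hδ : 0 < δ)
    (h : ∀ e, 0 < e → e < δ → x ≤ e * c) : x ≤ 0 := by
  have h1 : Filter.Tendsto (fun e : ℝ => e * c) (nhdsWithin 0 (Set.Ioi 0)) (nhds 0) := by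
    have : Continuous (fun e : ℝ => e * c) := by fun_prop
    simpa using (this.tendsto 0).mono_left nhdsWithin_le_nhds
  refine ge_of_tendsto h1 ?_
  filter_upwards [Ioo_mem_nhdsGT hδ] with e he using h e he.1 he.2

/-- Perturbing a single coordinate suffices. The sign of the perturbation gives the two bounds, and
where `u i ≠ 0` small perturbations keep its sign, so `|·|` is linear there and the bound becomes an
equality. -/
theorem isKKT_of_mem_argminOn {t : ℝ} (ht : 0 < t) {u : Fin N → ℝ}
    (h : u ∈ argminOn (energy A f t) Set.univ) : IsKKT A f t u := by
  intro i
  obtain ⟨c, key⟩ : ∃ c, ∀ e : ℝ,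
      e * corr A f u i ≤ e ^ 2 * c + t * (|u i + e| - |u i|) := by
    refine ⟨1 / 2 * l2sq (A *ᵥ Pi.single i 1), fun e => ?_⟩
    have h1 := h.2 (u + Pi.single i e) trivial
    have h2 := energy_expand A f t u (u + Pi.single i e)
    rw [l1_add_single, add_sub_cancel_left, single_dotProduct, mulVec_single_eq_smul,
      l2sq_smul] at h2
    linarith
  refine ⟨abs_le.2 ⟨?_, ?_⟩, fun hu => ?_, fun hu => ?_⟩
  · refine neg_le_iff_add_nonneg.2 (neg_nonpos.1 (nonpos_of_forall_le_mul (c := c) one_pos ?_))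
    intro e he _
    have h1 := key (-e)
    have h2 : |u i + -e| - |u i| ≤ e := by
      have := abs_add_le (u i) (-e); rw [abs_neg, abs_of_pos he] at this; linarith
    have h3 := mul_le_mul_of_nonneg_left h2 ht.le
    refine le_of_mul_le_mul_left ?_ he
    nlinarith
  · refine sub_nonpos.1 (nonpos_of_forall_le_mul (c := c) one_pos ?_)
    intro e he _
    have h1 := key e
    have h2 : |u i + e| - |u i| ≤ e := by
      have := abs_add_le (u i) e; rw [abs_of_pos he] at this; linarith
    have h3 := mul_le_mul_of_nonneg_left h2 ht.le
    refine le_of_mul_le_mul_left ?_ he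
    nlinarith
  · refine le_antisymm ?_ (sub_nonpos.1 (nonpos_of_forall_le_mul (c := c) hu ?_))
    · refine sub_nonpos.1 (nonpos_of_forall_le_mul (c := c) one_pos ?_)
      intro e he _
      have h1 := key e
      rw [abs_of_pos (by linarith), abs_of_pos hu] at h1
      refine le_of_mul_le_mul_left ?_ he
      nlinarith
    · intro e he he'
      have h1 := key (-e)
      rw [abs_of_pos (by linarith), abs_of_pos hu] at h1
      refine le_of_mul_le_mul_left ?_ he
      nlinarith
  · refine le_antisymm ?_ ?_
    · refine sub_nonpos.1 (nonpos_of_forall_le_mul (c := c) (neg_pos.2 hu) ?_)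
      intro e he he'
      have h1 := key e
      rw [abs_of_neg (by linarith), abs_of_neg hu] at h1
      refine le_of_mul_le_mul_left ?_ he
      nlinarith
    · refine sub_nonpos.1 (nonpos_of_forall_le_mul (c := c) one_pos ?_)
      intro e he _
      have h1 := key (-e)
      rw [abs_of_neg (by linarith), abs_of_neg hu] at h1
      refine le_of_mul_le_mul_left ?_ he
      nlinarith

theorem mem_solutionSet_iff {t : ℝ} (ht : 0 < t) {u : Fin N → ℝ} :
    u ∈ solutionSet A f t ↔ IsKKT A f t u :=
  ⟨fun h => isKKT_of_mem_argminOn ht (h.1 ht),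
    fun h => ⟨fun _ => h.mem_argminOn, fun h0 => absurd h0 ht.ne'⟩⟩

/-- Monotonicity: pairing `v - u` with the difference of correlations gives `‖A (v - u)‖²`, while
the subgradient inequalities make this pairing nonpositive. -/
theorem IsKKT.mulVec_eq {t : ℝ} {u v : Fin N → ℝ} (hu : IsKKT A f t u) (hv : IsKKT A f t v) :
    A *ᵥ u = A *ᵥ v := by
  have h1 : corr A f v = corr A f u - Aᵀ *ᵥ (A *ᵥ (v - u)) := by
    rw [← corr_add, add_sub_cancel]
  have h2 : (v - u) ⬝ᵥ (corr A f u - corr A f v) = l2sq (A *ᵥ (v - u)) := by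
    rw [h1, sub_sub_cancel, l2sq_mulVec]
  have h3 : l2sq (A *ᵥ (v - u)) = 0 := by
    refine le_antisymm ?_ (l2sq_nonneg _)
    rw [← h2, sub_dotProduct, dotProduct_sub, dotProduct_sub]
    linarith [hu.dotProduct_self, hv.dotProduct_self, hu.dotProduct_le v, hv.dotProduct_le u]
  have h4 := l2sq_eq_zero.1 h3
  rw [Matrix.mulVec_sub, sub_eq_zero] at h4
  exact h4.symm

theorem isKKT_zero {t : ℝ} (ht : ‖Aᵀ *ᵥ f‖ ≤ t) : IsKKT A f t 0 := by
  intro i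
  refine ⟨?_, by simp, by simp⟩
  have := norm_le_pi_norm (Aᵀ *ᵥ f) i
  simp only [corr, Matrix.mulVec_zero, sub_zero]
  exact this.trans ht

/-- The optimality conditions are stable under limits. -/
theorem isKKT_of_tendsto {s : ℝ} {w : ℝ → Fin N → ℝ} (hw : Continuous w)
    (h : ∀ᶠ τ in nhdsWithin s (Set.Ioi s), IsKKT A f τ (w τ)) : IsKKT A f s (w s) := by
  have hc : ∀ i, Filter.Tendsto (fun τ => corr A f (w τ) i) (nhdsWithin s (Set.Ioi s))
      (nhds (corr A f (w s) i)) := fun i =>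
    ((((continuous_apply i).comp ((continuous_corr A f).comp hw))).tendsto s).mono_left
      nhdsWithin_le_nhds
  have hs : Filter.Tendsto (fun τ : ℝ => τ) (nhdsWithin s (Set.Ioi s)) (nhds s) :=
    nhdsWithin_le_nhds
  have hwi : ∀ i, Filter.Tendsto (fun τ => w τ i) (nhdsWithin s (Set.Ioi s)) (nhds (w s i)) :=
    fun i => (((continuous_apply i).comp hw).tendsto s).mono_left nhdsWithin_le_nhds
  intro i
  refine ⟨le_of_tendsto_of_tendsto (hc i).abs hs (h.mono fun τ hτ => (hτ i).1), fun hi => ?_,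
    fun hi => ?_⟩
  · refine tendsto_nhds_unique_of_eventuallyEq (hc i) hs ?_
    filter_upwards [h, (hwi i).eventually (lt_mem_nhds hi)] with τ h1 h2 using (h1 i).2.1 h2
  · refine tendsto_nhds_unique_of_eventuallyEq (hc i) hs.neg ?_
    filter_upwards [h, (hwi i).eventually (gt_mem_nhds hi)] with τ h1 h2 using (h1 i).2.2 h2

/-- Limits of solutions for `t → 0` are `ℓ₁`-minimal least squares solutions. -/
theorem mem_argminOn_l1_of_tendsto {w : ℝ → Fin N → ℝ} (hw : Continuous w)
    (h : ∀ᶠ τ in nhdsWithin 0 (Set.Ioi 0), IsKKT A f τ (w τ)) :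
    w 0 ∈ argminOn l1 {v | Aᵀ *ᵥ (A *ᵥ v - f) = 0} := by
  constructor
  · have h0 := isKKT_of_tendsto hw h
    simp only [Set.mem_ofPred_eq, corr_neg_eq, neg_eq_zero]
    ext i
    exact abs_nonpos_iff.1 (h0 i).1
  · intro v hv
    simp only [Set.mem_ofPred_eq, corr_neg_eq, neg_eq_zero] at hv
    have hl : Filter.Tendsto (fun τ => l1 (w τ)) (nhdsWithin 0 (Set.Ioi 0)) (nhds (l1 (w 0))) :=
      ((continuous_l1.comp hw).tendsto 0).mono_left nhdsWithin_le_nhds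
    refine le_of_tendsto hl ?_
    filter_upwards [h, self_mem_nhdsWithin] with τ hτ hpos
    have h1 : corr A f (w τ) = -(Aᵀ *ᵥ (A *ᵥ (w τ - v))) := by
      have := corr_add A f v (w τ - v)
      rwa [add_sub_cancel, hv, zero_sub] at this
    -- Thus `τ * l1 (w τ) = w τ ⬝ᵥ corr ≤ v ⬝ᵥ corr ≤ τ * l1 v`; dividing by `τ` gives the bound
    -- that survives the limit.
    have h2 : (w τ - v) ⬝ᵥ corr A f (w τ) ≤ 0 := by
      rw [h1, dotProduct_neg, ← l2sq_mulVec]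
      exact neg_nonpos.2 (l2sq_nonneg _)
    rw [sub_dotProduct, hτ.dotProduct_self] at h2
    exact le_of_mul_le_mul_left (by linarith [hτ.dotProduct_le v]) (Set.mem_Ioi.1 hpos)

theorem mem_solutionSet_of_tendsto {s : ℝ} (hs : 0 ≤ s) {w : ℝ → Fin N → ℝ} (hw : Continuous w)
    (h : ∀ᶠ τ in nhdsWithin s (Set.Ioi s), IsKKT A f τ (w τ)) : w s ∈ solutionSet A f s := by
  refine ⟨fun _ => (isKKT_of_tendsto hw h).mem_argminOn, ?_⟩
  rintro rfl
  exact mem_argminOn_l1_of_tendsto hw h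

end

/-! ### Existence and structure of nonnegative least squares solutions -/

section

/-- The metric on `Fin n → ℝ` is the maximum metric, so the nearest point is taken in
`EuclideanSpace`. -/
theorem exists_forall_l2sq_sub_le {n : ℕ} {S : Set (Fin n → ℝ)} (hS : IsClosed S)
    (hne : S.Nonempty) (b : Fin n → ℝ) : ∃ x ∈ S, ∀ y ∈ S, l2sq (x - b) ≤ l2sq (y - b) := by
  have hd : ∀ x : EuclideanSpace ℝ (Fin n), l2sq (x.ofLp - b) = dist (WithLp.toLp 2 b) x ^ 2 := by
    intro x
    rw [dist_comm, dist_eq_norm, EuclideanSpace.real_norm_sq_eq]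
    simp [l2sq]
  have hc : IsClosed {x : EuclideanSpace ℝ (Fin n) | x.ofLp ∈ S} :=
    hS.preimage (PiLp.continuous_ofLp 2 _)
  obtain ⟨y, hy⟩ := hne
  obtain ⟨x, hx, hx'⟩ := hc.exists_infDist_eq_dist ⟨WithLp.toLp 2 y, hy⟩ (WithLp.toLp 2 b)
  refine ⟨x.ofLp, hx, fun y hy => ?_⟩
  have := Metric.infDist_le_dist_of_mem (x := WithLp.toLp 2 b)
    (show WithLp.toLp 2 y ∈ {x : EuclideanSpace ℝ (Fin n) | x.ofLp ∈ S} from hy)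
  rw [hx'] at this
  have h2 := hd (WithLp.toLp 2 y)
  rw [hd x]
  exact (pow_le_pow_left₀ dist_nonneg this 2).trans h2.symm.le

theorem l2sq_combo_le {n : ℕ} (x y : Fin n → ℝ) {e : ℝ} (h0 : 0 ≤ e) (h1 : e ≤ 1) :
    l2sq (x + e • (y - x)) ≤ (1 - e) * l2sq x + e * l2sq y := by
  have h2 : l2sq y = l2sq x + 2 * (x ⬝ᵥ (y - x)) + l2sq (y - x) := by
    rw [← l2sq_add, add_sub_cancel]
  rw [l2sq_add, l2sq_smul, dotProduct_smul, smul_eq_mul, h2]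
  nlinarith [mul_nonneg (mul_nonneg h0 (sub_nonneg.2 h1)) (l2sq_nonneg (y - x))]

/-- A convex set has at most one element of minimal Euclidean norm. -/
theorem eq_of_mem_argminOn_l2sq {n : ℕ} {S : Set (Fin n → ℝ)} (hS : Convex ℝ S)
    {x y : Fin n → ℝ} (hx : x ∈ argminOn l2sq S) (hy : y ∈ argminOn l2sq S) : x = y := by
  have hm : x + (1 / 2 : ℝ) • (y - x) ∈ S := by
    convert hS hx.1 hy.1 (a := 1 / 2) (b := 1 / 2) (by norm_num) (by norm_num) (by norm_num) using 1
    ext i; simp; ring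
  have h1 := hx.2 _ hm
  have h2 := le_antisymm (hx.2 _ hy.1) (hy.2 _ hx.1)
  have h3 : l2sq y = l2sq x + 2 * (x ⬝ᵥ (y - x)) + l2sq (y - x) := by
    rw [← l2sq_add, add_sub_cancel]
  rw [l2sq_add, l2sq_smul, dotProduct_smul, smul_eq_mul] at h1
  have h4 : l2sq (y - x) = 0 := le_antisymm (by linarith) (l2sq_nonneg _)
  exact (sub_eq_zero.1 (l2sq_eq_zero.1 h4)).symm

variable {m N : ℕ} (A : Matrix (Fin m) (Fin N) ℝ)

/-- Linear least squares over a subspace with sign constraints has a solution. -/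
theorem exists_leastSquares (b : Fin m → ℝ) (p : Fin N → ℝ) (P : Finset (Fin N)) :
    ∀ V : Submodule ℝ (Fin N → ℝ), ∃ d, (d ∈ V ∧ ∀ i ∈ P, 0 ≤ d i * p i) ∧
      ∀ y, (y ∈ V ∧ ∀ i ∈ P, 0 ≤ y i * p i) → l2sq (A *ᵥ d - b) ≤ l2sq (A *ᵥ y - b) := by
  -- The objective need not be coercive, since `A` may have a kernel, so compactness is replaced by
  -- induction on the sign constraints. The subspace `V` stays general because a constraint that
  -- becomes tight is absorbed into it.
  induction P using Finset.induction_on with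
  | empty =>
    intro V
    obtain ⟨x, ⟨d, hd, rfl⟩, h⟩ := exists_forall_l2sq_sub_le
      (V.map A.mulVecLin).closed_of_finiteDimensional ⟨0, Submodule.zero_mem _⟩ b
    exact ⟨d, ⟨hd, by simp⟩, fun y hy => h _ ⟨y, hy.1, rfl⟩⟩
  | insert i P hi ih =>
    intro V
    obtain ⟨x, ⟨hxV, hxP⟩, hx⟩ := ih V
    by_cases hxi : 0 ≤ x i * p i
    · refine ⟨x, ⟨hxV, ?_⟩, fun y hy => hx y ⟨hy.1, fun j hj => hy.2 j (Finset.mem_insert_of_mem hj)⟩⟩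
      intro j hj
      rcases Finset.mem_insert.1 hj with rfl | hj
      exacts [hxi, hxP j hj]
    push Not at hxi
    obtain ⟨d, ⟨hdV, hdP⟩, hd⟩ := ih (V ⊓ LinearMap.ker (LinearMap.proj i))
    have hdi : d i = 0 := hdV.2
    refine ⟨d, ⟨hdV.1, ?_⟩, ?_⟩
    · intro j hj
      rcases Finset.mem_insert.1 hj with rfl | hj
      exacts [by simp [hdi], hdP j hj]
    · intro y ⟨hyV, hyP⟩
      have hyi := hyP i (Finset.mem_insert_self _ _)
      have hpos : 0 < y i * p i - x i * p i := by linarith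
      -- The segment from `x`, which violates constraint `i`, to the feasible `y` meets the
      -- hyperplane of vanishing coordinate `i` at this `e`. As `x` is at least as good as `y`,
      -- convexity makes the crossing point at least as good as `y`.
      set e := -(x i * p i) / (y i * p i - x i * p i) with he
      have he0 : 0 ≤ e := div_nonneg (by linarith) hpos.le
      have he1 : e ≤ 1 := (div_le_one hpos).2 (by linarith)
      have hpi : p i ≠ 0 := by rintro h; simp [h] at hxi
      have hz := hd (x + e • (y - x)) ⟨⟨V.add_mem hxV (V.smul_mem _ (V.sub_mem hyV hxV)), ?_⟩, ?_⟩
      · have h1 : A *ᵥ (x + e • (y - x)) - b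
            = (A *ᵥ x - b) + e • ((A *ᵥ y - b) - (A *ᵥ x - b)) := by
          rw [Matrix.mulVec_add, Matrix.mulVec_smul, Matrix.mulVec_sub]
          ext; simp; ring
        rw [h1] at hz
        have h2 := l2sq_combo_le (A *ᵥ x - b) (A *ᵥ y - b) he0 he1
        have h3 := hx y ⟨hyV, fun j hj => hyP j (Finset.mem_insert_of_mem hj)⟩
        nlinarith
      · have : (x i + e * (y i - x i)) * p i = 0 := by
          have : e * (y i * p i - x i * p i) = -(x i * p i) := div_mul_cancel₀ _ hpos.ne'
          linear_combination this
        simpa [hpi] using this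
      · intro j hj
        have h1 := hxP j hj
        have h2 := hyP j (Finset.mem_insert_of_mem hj)
        have : (x + e • (y - x)) j * p j = (1 - e) * (x j * p j) + e * (y j * p j) := by
          simp; ring
        rw [this]
        exact add_nonneg (mul_nonneg (by linarith) h1) (mul_nonneg he0 h2)

variable (f : Fin m → ℝ)

/-- The feasible set of the nonnegative least squares problem at `(t, u)`. -/
def feasible (t : ℝ) (u : Fin N → ℝ) : Set (Fin N → ℝ) :=
  {d | (∀ i, i ∉ equicorrelationSet A f t u → d i = 0) ∧
    ∀ i ∈ equicorrelationSet A f t u \ activeSet u, 0 ≤ d i * subgrad A f t u i}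

theorem convex_feasible (t : ℝ) (u : Fin N → ℝ) : Convex ℝ (feasible A f t u) := by
  intro x hx y hy a b ha hb _
  refine ⟨fun i hi => by simp [hx.1 i hi, hy.1 i hi], fun i hi => ?_⟩
  have : (a • x + b • y) i * subgrad A f t u i
      = a * (x i * subgrad A f t u i) + b * (y i * subgrad A f t u i) := by
    simp; ring
  rw [this]
  exact add_nonneg (mul_nonneg ha (hx.2 i hi)) (mul_nonneg hb (hy.2 i hi))

theorem isClosed_feasible (t : ℝ) (u : Fin N → ℝ) : IsClosed (feasible A f t u) := by
  have : feasible A f t u = (⋂ i, ⋂ (_ : i ∉ equicorrelationSet A f t u), {d | d i = 0}) ∩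
      ⋂ i, ⋂ (_ : i ∈ equicorrelationSet A f t u \ activeSet u),
        {d | 0 ≤ d i * subgrad A f t u i} := by
    ext d; simp only [feasible, Set.mem_inter_iff, Set.mem_iInter]; rfl
  rw [this]
  refine IsClosed.inter ?_ ?_
  · exact isClosed_iInter fun i => isClosed_iInter fun _ =>
      isClosed_eq (continuous_apply i) continuous_const
  · exact isClosed_iInter fun i => isClosed_iInter fun _ =>
      isClosed_le continuous_const ((continuous_apply i).mul continuous_const)

theorem directions_nonempty (t : ℝ) (u : Fin N → ℝ) : (directions A f t u).Nonempty := by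
  classical
  obtain ⟨d, hd, h⟩ := exists_leastSquares A ((1 / t) • (f - A *ᵥ u)) (subgrad A f t u)
    (Finset.univ.filter fun i => i ∈ equicorrelationSet A f t u \ activeSet u)
    (⨅ i : {i // i ∉ equicorrelationSet A f t u}, LinearMap.ker (LinearMap.proj i.1))
  have hiff : ∀ y : Fin N → ℝ, (y ∈ (⨅ i : {i // i ∉ equicorrelationSet A f t u},
      LinearMap.ker (LinearMap.proj i.1 : (Fin N → ℝ) →ₗ[ℝ] ℝ)) ∧
      ∀ i ∈ (Finset.univ.filter fun i => i ∈ equicorrelationSet A f t u \ activeSet u),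
        0 ≤ y i * subgrad A f t u i) ↔ y ∈ feasible A f t u := by
    intro y
    simp [feasible, Submodule.mem_iInf]
  exact ⟨d, (hiff d).1 hd, fun y hy => h y ((hiff y).2 hy)⟩

theorem mem_directions {t : ℝ} {u d : Fin N → ℝ} : d ∈ directions A f t u ↔
    d ∈ feasible A f t u ∧ ∀ y ∈ feasible A f t u,
      l2sq (A *ᵥ d - (1 / t) • (f - A *ᵥ u)) ≤ l2sq (A *ᵥ y - (1 / t) • (f - A *ᵥ u)) :=
  Iff.rfl

theorem convex_directions (t : ℝ) (u : Fin N → ℝ) : Convex ℝ (directions A f t u) := by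
  intro x hx y hy a b ha hb hab
  refine ⟨convex_feasible A f t u hx.1 hy.1 ha hb hab, fun z hz => ?_⟩
  have h1 := hx.2 z hz
  have h2 := hy.2 z hz
  dsimp only at h1 h2 ⊢
  set c := (1 / t) • (f - A *ᵥ u)
  obtain rfl : a = 1 - b := by linarith
  have h3 : A *ᵥ ((1 - b) • x + b • y) - c = (A *ᵥ x - c) + b • ((A *ᵥ y - c) - (A *ᵥ x - c)) := by
    rw [Matrix.mulVec_add, Matrix.mulVec_smul, Matrix.mulVec_smul]
    ext; simp; ring
  rw [h3]
  have h4 := l2sq_combo_le (A *ᵥ x - c) (A *ᵥ y - c) hb (by linarith)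
  nlinarith

theorem isClosed_directions (t : ℝ) (u : Fin N → ℝ) : IsClosed (directions A f t u) := by
  have : directions A f t u = feasible A f t u ∩ ⋂ y ∈ feasible A f t u,
      {d | l2sq (A *ᵥ d - (1 / t) • (f - A *ᵥ u)) ≤ l2sq (A *ᵥ y - (1 / t) • (f - A *ᵥ u))} := by
    ext d; simp only [mem_directions, Set.mem_inter_iff, Set.mem_iInter]; rfl
  rw [this]
  refine (isClosed_feasible A f t u).inter (isClosed_biInter fun y _ => isClosed_le ?_ ?_)
  · exact continuous_l2sq.comp (by fun_prop)
  · exact continuous_const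

theorem exists_mem_argminOn_directions (t : ℝ) (u : Fin N → ℝ) :
    ∃ d, d ∈ argminOn l2sq (directions A f t u) := by
  obtain ⟨d, hd, h⟩ := exists_forall_l2sq_sub_le (isClosed_directions A f t u)
    (directions_nonempty A f t u) 0
  exact ⟨d, hd, fun y hy => by simpa using h y hy⟩

variable {A f}

/-- If the correlations of `A d` agree with the subgradient on the equicorrelation set, then the
least squares solutions are the feasible vectors with the same image as `d`. -/
theorem mem_directions_iff {t : ℝ} {u d : Fin N → ℝ} (hd : d ∈ feasible A f t u)
    (h : ∀ i ∈ equicorrelationSet A f t u, (Aᵀ *ᵥ (A *ᵥ d)) i = subgrad A f t u i)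
    (y : Fin N → ℝ) :
    y ∈ directions A f t u ↔ y ∈ feasible A f t u ∧ A *ᵥ y = A *ᵥ d := by
  -- Pythagoras: `y - d` is supported on the equicorrelation set, where the gradient of the least
  -- squares objective at `d` vanishes.
  have key : ∀ y ∈ feasible A f t u, l2sq (A *ᵥ y - (1 / t) • (f - A *ᵥ u))
      = l2sq (A *ᵥ d - (1 / t) • (f - A *ᵥ u)) + l2sq (A *ᵥ (y - d)) := by
    intro y hy
    have h1 : A *ᵥ y - (1 / t) • (f - A *ᵥ u)
        = A *ᵥ (y - d) + (A *ᵥ d - (1 / t) • (f - A *ᵥ u)) := by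
      rw [Matrix.mulVec_sub]; abel
    have h2 : (A *ᵥ (y - d)) ⬝ᵥ (A *ᵥ d - (1 / t) • (f - A *ᵥ u)) = 0 := by
      rw [mulVec_dotProduct_eq, Matrix.mulVec_sub, Matrix.mulVec_smul]
      refine Finset.sum_eq_zero fun i _ => ?_
      by_cases hi : i ∈ equicorrelationSet A f t u
      · have := h i hi
        rw [Pi.sub_apply (Aᵀ *ᵥ (A *ᵥ d)), this, subgrad, sub_self, mul_zero]
      · simp [hy.1 i hi, hd.1 i hi]
    rw [h1, l2sq_add, h2]; ring
  constructor
  · intro hy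
    refine ⟨hy.1, ?_⟩
    have h1 := hy.2 d hd
    dsimp only at h1
    rw [key y hy.1] at h1
    have h2 : l2sq (A *ᵥ (y - d)) = 0 := le_antisymm (by linarith) (l2sq_nonneg _)
    rw [l2sq_eq_zero, Matrix.mulVec_sub, sub_eq_zero] at h2
    exact h2
  · rintro ⟨hy, hyd⟩
    refine ⟨hy, fun z hz => ?_⟩
    dsimp only
    rw [key z hz, hyd]
    linarith [l2sq_nonneg (A *ᵥ (z - d))]

end

/-! ### A single step: existence, uniqueness and positive length -/

section

variable {m N : ℕ} {A : Matrix (Fin m) (Fin N) ℝ} {f : Fin m → ℝ}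

/-- First order optimality of a least squares solution along a feasible coordinate direction. -/
theorem mul_sub_nonpos_of_feasible {t : ℝ} {u d : Fin N → ℝ} (hd : d ∈ directions A f t u)
    (i : Fin N) {c δ : ℝ} (hδ : 0 < δ)
    (h : ∀ e, 0 < e → e < δ → d + Pi.single i (c * e) ∈ feasible A f t u) :
    c * (corr A f u i / t - (Aᵀ *ᵥ (A *ᵥ d)) i) ≤ 0 := by
  have h2 : 2 * (c * (corr A f u i / t - (Aᵀ *ᵥ (A *ᵥ d)) i)) ≤ 0 := by
    refine nonpos_of_forall_le_mul (c := c ^ 2 * l2sq (A *ᵥ Pi.single i 1)) hδ fun e he he' => ?_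
    have h1 := hd.2 _ (h e he he')
    have h3 : A *ᵥ (d + Pi.single i (c * e)) - (1 / t) • (f - A *ᵥ u)
        = A *ᵥ Pi.single i (c * e) + (A *ᵥ d - (1 / t) • (f - A *ᵥ u)) := by
      rw [Matrix.mulVec_add]; abel
    have h4 : (Aᵀ *ᵥ (A *ᵥ d - (1 / t) • (f - A *ᵥ u))) i
        = (Aᵀ *ᵥ (A *ᵥ d)) i - corr A f u i / t := by
      rw [Matrix.mulVec_sub, Pi.sub_apply, ← subgrad_apply, Matrix.mulVec_smul]; rfl
    dsimp only at h1
    rw [h3, l2sq_add, mulVec_dotProduct_eq, single_dotProduct, h4, mulVec_single_eq_smul,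
      l2sq_smul] at h1
    refine le_of_mul_le_mul_left ?_ he
    nlinarith
  linarith

theorem add_single_mem_feasible {t : ℝ} {u d : Fin N → ℝ} (hd : d ∈ feasible A f t u) {i : Fin N}
    (hi : i ∈ equicorrelationSet A f t u) {e : ℝ}
    (h : u i = 0 → 0 ≤ (d i + e) * subgrad A f t u i) :
    d + Pi.single i e ∈ feasible A f t u := by
  refine ⟨fun j hj => ?_, fun j hj => ?_⟩
  · have : j ≠ i := by rintro rfl; exact hj hi
    simp [this, hd.1 j hj]
  · by_cases hji : j = i
    · subst hji
      have : u j = 0 := by simpa [activeSet] using hj.2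
      simpa using h this
    · simpa [hji] using hd.2 j hj

/-- Active coordinates carry no sign constraint, so both directions `±1` are feasible. -/
theorem corr_eq_of_active {t : ℝ} {u d : Fin N → ℝ} (hd : d ∈ directions A f t u) {i : Fin N}
    (hi : i ∈ equicorrelationSet A f t u) (hu : u i ≠ 0) :
    (Aᵀ *ᵥ (A *ᵥ d)) i = corr A f u i / t := by
  have h1 := mul_sub_nonpos_of_feasible hd i (c := 1) one_pos fun e _ _ =>
    add_single_mem_feasible hd.1 hi fun h => absurd h hu
  have h2 := mul_sub_nonpos_of_feasible hd i (c := -1) one_pos fun e _ _ =>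
    add_single_mem_feasible hd.1 hi fun h => absurd h hu
  linarith

/-- Complementary slackness, with `σ = ±1` the sign of the correlation: moving along `σ` is always
feasible, and moving back is feasible for a while if `d i ≠ 0`. -/
theorem directions_inactive {t : ℝ} {u d : Fin N → ℝ} (hd : d ∈ directions A f t u) {i : Fin N}
    {σ : ℝ} (hσ : σ ^ 2 = 1) (hi : corr A f u i = σ * t) (ht : 0 < t) (hu : u i = 0) :
    0 ≤ d i * σ ∧ σ * (σ - (Aᵀ *ᵥ (A *ᵥ d)) i) ≤ 0 ∧
      (d i ≠ 0 → (Aᵀ *ᵥ (A *ᵥ d)) i = σ) := by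
  have hE : i ∈ equicorrelationSet A f t u := by
    rw [mem_equicorrelationSet, hi, abs_mul, abs_of_pos ht]
    rcases mul_self_eq_one_iff.1 ((sq σ).symm.trans hσ) with h | h <;> simp [h]
  have hp : subgrad A f t u i = σ := by
    rw [subgrad_apply, hi, mul_div_assoc, div_self ht.ne', mul_one]
  have hp' : corr A f u i / t = σ := by rw [← subgrad_apply, hp]
  have hdi : 0 ≤ d i * σ := by
    have := hd.1.2 i ⟨hE, by simp [activeSet, hu]⟩
    rwa [hp] at this
  have h1 := mul_sub_nonpos_of_feasible hd i (c := σ) one_pos fun e he _ =>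
    add_single_mem_feasible hd.1 hE fun _ => by rw [hp]; nlinarith
  rw [hp'] at h1
  refine ⟨hdi, h1, fun hne => ?_⟩
  have hσ0 : σ ≠ 0 := by rintro rfl; norm_num at hσ
  have hpos : 0 < d i * σ := lt_of_le_of_ne hdi (mul_ne_zero hne hσ0).symm
  have h2 := mul_sub_nonpos_of_feasible hd i (c := -σ) hpos fun e he he' =>
    add_single_mem_feasible hd.1 hE fun _ => by rw [hp]; nlinarith
  rw [hp'] at h2
  have h3 : σ * (σ - (Aᵀ *ᵥ (A *ᵥ d)) i) = 0 := by linarith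
  have := (mul_eq_zero.1 h3).resolve_left hσ0
  linarith

/-- One coordinate of `IsKKT` at parameter `t - h`, where `a`, `b`, `c`, `d` stand for the entries
of `u`, the correlations, `Aᵀ A d` and `d`. Strict inequalities persist by continuity; the tight
ones move at the rate of the bound or stay inside it. -/
theorem eventually_optimality {t a b c d : ℝ} (ht : 0 < t) (hb : |b| ≤ t) (ha : 0 < a → b = t)
    (ha' : a < 0 → b = -t) (hd : |b| ≠ t → d = 0) (hc : a ≠ 0 → c = b / t)
    (hp : b = t → a = 0 → 0 ≤ d ∧ 1 ≤ c ∧ (d ≠ 0 → c = 1))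
    (hn : b = -t → a = 0 → d ≤ 0 ∧ c ≤ -1 ∧ (d ≠ 0 → c = -1)) :
    ∀ᶠ h in nhdsWithin (0 : ℝ) (Set.Ioi 0), |b - h * c| ≤ t - h ∧
      (0 < a + h * d → b - h * c = t - h) ∧ (a + h * d < 0 → b - h * c = -(t - h)) := by
  have ev : ∀ g : ℝ → ℝ, Continuous g → 0 < g 0 →
      ∀ᶠ h in nhdsWithin (0 : ℝ) (Set.Ioi 0), 0 < g h := fun g hg h0 =>
    nhdsWithin_le_nhds ((hg.tendsto 0).eventually (lt_mem_nhds h0))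
  have hpos : ∀ᶠ h in nhdsWithin (0 : ℝ) (Set.Ioi 0), 0 < h := self_mem_nhdsWithin
  have hlt := ev (fun h => t - h) (by fun_prop) (by simpa)
  have div1 : t / t = 1 := div_self ht.ne'
  rcases lt_trichotomy a 0 with h0 | h0 | h0
  · have hb' := ha' h0
    have hc' := hc h0.ne
    rw [hb', neg_div, div1] at hc'
    filter_upwards [hlt, ev (fun h => -(a + h * d)) (by fun_prop) (by simpa)] with h h1 h2
    rw [hb', hc', show -t - h * -1 = -(t - h) by ring, abs_neg, abs_of_pos h1]
    exact ⟨le_rfl, fun h => by linarith, fun _ => rfl⟩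
  · by_cases hbt : |b| = t
    · rcases eq_or_eq_neg_of_abs_eq hbt with hb' | hb'
      · obtain ⟨h1, h2, h3⟩ := hp hb' h0
        filter_upwards [hlt, hpos, ev (fun h => (b - h * c) + (t - h)) (by fun_prop)
          (by simp; linarith)] with h h4 h5 h6
        refine ⟨abs_le.2 ⟨by linarith, by nlinarith⟩, fun hh => ?_, fun hh => ?_⟩
        · have : d ≠ 0 := by rintro rfl; simp [h0] at hh
          rw [h3 this, hb']; ring
        · nlinarith
      · obtain ⟨h1, h2, h3⟩ := hn hb' h0
        filter_upwards [hlt, hpos, ev (fun h => (t - h) - (b - h * c)) (by fun_prop)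
          (by simp; linarith)] with h h4 h5 h6
        refine ⟨abs_le.2 ⟨by nlinarith, by linarith⟩, fun hh => ?_, fun hh => ?_⟩
        · nlinarith
        · have : d ≠ 0 := by rintro rfl; simp [h0] at hh
          rw [h3 this, hb']; ring
    · have hd0 := hd hbt
      filter_upwards [ev (fun h => (t - h) - |b - h * c|) (by fun_prop)
        (by simpa using lt_of_le_of_ne hb hbt)] with h h1
      exact ⟨by linarith, by simp [h0, hd0], by simp [h0, hd0]⟩
  · have hb' := ha h0
    have hc' := hc h0.ne'
    rw [hb', div1] at hc'
    filter_upwards [hlt, ev (fun h => a + h * d) (by fun_prop) (by simpa)] with h h1 h2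
    rw [hb', hc', show t - h * 1 = t - h by ring, abs_of_pos h1]
    exact ⟨le_rfl, fun _ => rfl, fun h => by linarith⟩

/-- Moving along a least squares direction preserves optimality for a short time. -/
theorem IsKKT.exists_segment {t : ℝ} {u d : Fin N → ℝ} (hu : IsKKT A f t u) (ht : 0 < t)
    (hd : d ∈ directions A f t u) :
    ∃ s, 0 < s ∧ s < t ∧ ∀ τ ∈ Set.Icc s t, IsKKT A f τ (u + (t - τ) • d) := by
  have h : ∀ᶠ h in nhdsWithin (0 : ℝ) (Set.Ioi 0), IsKKT A f (t - h) (u + h • d) := by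
    simp only [IsKKT, corr_add_smul, Pi.add_apply, Pi.smul_apply, smul_eq_mul]
    refine Filter.eventually_all.2 fun i => ?_
    refine eventually_optimality ht (hu i).1 (hu i).2.1 (hu i).2.2 (fun hi => ?_) (fun hi => ?_)
      (fun hb ha => ?_) (fun hb ha => ?_)
    · exact hd.1.1 i (by rwa [mem_equicorrelationSet])
    · refine corr_eq_of_active hd ?_ hi
      rw [mem_equicorrelationSet]
      rcases lt_or_gt_of_ne hi with h | h
      · rw [(hu i).2.2 h, abs_neg, abs_of_pos ht]
      · rw [(hu i).2.1 h, abs_of_pos ht]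
    · obtain ⟨h1, h2, h3⟩ := directions_inactive hd (σ := 1) (by norm_num) (by simpa using hb) ht ha
      exact ⟨by linarith, by linarith, h3⟩
    · obtain ⟨h1, h2, h3⟩ := directions_inactive hd (σ := -1) (by norm_num) (by simpa using hb) ht ha
      exact ⟨by linarith, by linarith, h3⟩
  obtain ⟨δ, hδ, hδ'⟩ := mem_nhdsGT_iff_exists_Ioo_subset.1 h
  have hδ : 0 < δ := hδ
  refine ⟨t - min (δ / 2) (t / 2), ?_, ?_, fun τ hτ => ?_⟩
  · linarith [min_le_right (δ / 2) (t / 2)]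
  · linarith [lt_min (half_pos hδ) (half_pos ht)]
  · rcases hτ.2.eq_or_lt with rfl | hlt
    · simpa using hu
    · have := hδ' (show t - τ ∈ Set.Ioo 0 δ from
        ⟨by linarith, by linarith [min_le_left (δ / 2) (t / 2), hτ.1]⟩)
      simpa using this

/-- The infimum is attained because solutions survive limits from the right, including the change of
problem at `0`. -/
theorem exists_isLeast_parameter {t : ℝ} {u d : Fin N → ℝ} (hu : IsKKT A f t u) (ht : 0 < t)
    (hd : d ∈ directions A f t u) :
    ∃ t', IsLeast {s | 0 ≤ s ∧ s ≤ t ∧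
      ∀ τ ∈ Set.Icc s t, u + (t - τ) • d ∈ solutionSet A f τ} t' := by
  set S := {s | 0 ≤ s ∧ s ≤ t ∧ ∀ τ ∈ Set.Icc s t, u + (t - τ) • d ∈ solutionSet A f τ} with hS
  obtain ⟨s, hs0, hst, hs⟩ := hu.exists_segment ht hd
  have hsS : s ∈ S := ⟨hs0.le, hst.le, fun τ hτ =>
    (mem_solutionSet_iff (hs0.trans_le hτ.1)).2 (hs τ hτ)⟩
  have hbdd : BddBelow S := ⟨0, fun x hx => hx.1⟩
  have hlt : sInf S < t := (csInf_le hbdd hsS).trans_lt hst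
  have hmem : ∀ τ, sInf S < τ → τ ≤ t → u + (t - τ) • d ∈ solutionSet A f τ := by
    intro τ h1 h2
    obtain ⟨x, hx, hxτ⟩ := exists_lt_of_csInf_lt ⟨s, hsS⟩ h1
    exact hx.2.2 τ ⟨hxτ.le, h2⟩
  have h0 : 0 ≤ sInf S := le_csInf ⟨s, hsS⟩ fun x hx => hx.1
  refine ⟨sInf S, ⟨h0, hlt.le, fun τ hτ => ?_⟩, fun x hx => csInf_le hbdd hx⟩
  rcases hτ.1.eq_or_lt with rfl | h1
  · refine mem_solutionSet_of_tendsto (w := fun τ => u + (t - τ) • d) h0 (by fun_prop) ?_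
    filter_upwards [Ioo_mem_nhdsGT hlt] with τ hτ
    exact (mem_solutionSet_iff (h0.trans_lt hτ.1)).1 (hmem τ hτ.1 hτ.2.le)
  · exact hmem τ h1 hτ.2

theorem exists_isStep {t : ℝ} {u : Fin N → ℝ} (hu : IsKKT A f t u) (ht : 0 < t) :
    ∃ d t' u', IsStep A f t u d t' u' := by
  obtain ⟨d, hd⟩ := exists_mem_argminOn_directions A f t u
  obtain ⟨t', ht'⟩ := exists_isLeast_parameter hu ht hd.1
  exact ⟨d, t', _, ht.ne', hd, ht', rfl⟩

theorem IsStep.unique {t t₁ t₂ : ℝ} {u d₁ d₂ u₁ u₂ : Fin N → ℝ} (h₁ : IsStep A f t u d₁ t₁ u₁)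
    (h₂ : IsStep A f t u d₂ t₂ u₂) : d₁ = d₂ ∧ t₁ = t₂ ∧ u₁ = u₂ := by
  obtain rfl := eq_of_mem_argminOn_l2sq (convex_directions A f t u) h₁.direction h₂.direction
  obtain rfl := h₁.parameter.unique h₂.parameter
  exact ⟨rfl, rfl, h₁.iterate.trans h₂.iterate.symm⟩

theorem IsStep.nonneg {t t' : ℝ} {u d u' : Fin N → ℝ} (h : IsStep A f t u d t' u') : 0 ≤ t' :=
  h.parameter.1.1

theorem IsStep.le {t t' : ℝ} {u d u' : Fin N → ℝ} (h : IsStep A f t u d t' u') : t' ≤ t :=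
  h.parameter.1.2.1

theorem IsStep.pos {t t' : ℝ} {u d u' : Fin N → ℝ} (h : IsStep A f t u d t' u') : 0 < t :=
  lt_of_le_of_ne (h.nonneg.trans h.le) h.ne_zero.symm

theorem IsStep.isKKT {t t' : ℝ} {u d u' : Fin N → ℝ} (h : IsStep A f t u d t' u') {τ : ℝ}
    (hτ : 0 < τ) (h1 : t' ≤ τ) (h2 : τ ≤ t) : IsKKT A f τ (u + (t - τ) • d) :=
  (mem_solutionSet_iff hτ).1 (h.parameter.1.2.2 τ ⟨h1, h2⟩)

theorem IsStep.isKKT_left {t t' : ℝ} {u d u' : Fin N → ℝ} (h : IsStep A f t u d t' u') :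
    IsKKT A f t u := by
  simpa using h.isKKT h.pos h.le le_rfl

theorem IsStep.isKKT_right {t t' : ℝ} {u d u' : Fin N → ℝ} (h : IsStep A f t u d t' u')
    (ht' : 0 < t') : IsKKT A f t' u' := by
  rw [h.iterate]; exact h.isKKT ht' le_rfl h.le

theorem IsStep.lt {t t' : ℝ} {u d u' : Fin N → ℝ} (h : IsStep A f t u d t' u') : t' < t := by
  obtain ⟨s, hs0, hst, hs⟩ := h.isKKT_left.exists_segment h.pos h.direction.1
  exact (h.parameter.2 ⟨hs0.le, hst.le, fun τ hτ =>
    (mem_solutionSet_iff (hs0.trans_le hτ.1)).2 (hs τ hτ)⟩).trans_lt hst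

end

/-! ### Finite termination -/

section

variable {m N : ℕ} {A : Matrix (Fin m) (Fin N) ℝ} {f : Fin m → ℝ}

/-- An affine function of `s` between `-s` and `s` that touches a bound at an interior point
coincides with it. If the coordinate crossed zero, the correlation would be `s` on one side and `-s`
on the other, yet one side already fixes its slope. -/
theorem interior_optimality {t t' τ a b c d : ℝ} (ht' : 0 ≤ t') (h1 : t' < τ) (h2 : τ < t)
    (H : ∀ s, t' < s → s ≤ t → |b - (t - s) * c| ≤ s ∧ (0 < a + (t - s) * d → b - (t - s) * c = s) ∧
      (a + (t - s) * d < 0 → b - (t - s) * c = -s)) :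
    (|b - (t - τ) * c| = τ → c * τ = b - (t - τ) * c) ∧ (a + (t - τ) * d = 0 → d = 0) := by
  obtain ⟨Ht, Htp, Htn⟩ := H t (h1.trans h2) le_rfl
  obtain ⟨Hl, Hlp, Hln⟩ := H ((t' + τ) / 2) (by linarith) (by linarith)
  obtain ⟨Hr, Hrp, Hrn⟩ := H ((τ + t) / 2) (by linarith) (by linarith)
  rw [abs_le] at Ht Hl
  constructor
  · intro h
    rcases eq_or_eq_neg_of_abs_eq h with h | h
    · have hc : c = 1 := by
        apply le_antisymm
        · by_contra! hc
          nlinarith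
        · by_contra! hc
          nlinarith
      rw [h, hc, one_mul]
    · have hc : c = -1 := by
        apply le_antisymm
        · by_contra! hc
          nlinarith
        · by_contra! hc
          nlinarith
      rw [h, hc, neg_one_mul]
  · intro h
    by_contra hd
    rcases lt_or_gt_of_ne hd with hd | hd
    · have e1 := Htp (by nlinarith)
      have e2 := Hrp (by nlinarith)
      have e3 := Hln (by nlinarith)
      have hc : c = 1 := by
        have : (t - (τ + t) / 2) * (c - 1) = 0 := by linarith
        rcases mul_eq_zero.1 this with h | h <;> linarith
      rw [hc] at e3
      linarith
    · have e1 := Htn (by nlinarith)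
      have e2 := Hrn (by nlinarith)
      have e3 := Hlp (by nlinarith)
      have hc : c = -1 := by
        have : (t - (τ + t) / 2) * (c + 1) = 0 := by linarith
        rcases mul_eq_zero.1 this with h | h <;> linarith
      rw [hc] at e3
      linarith

theorem IsStep.interior {t t' τ : ℝ} {u d u' : Fin N → ℝ} (h : IsStep A f t u d t' u')
    (h1 : t' < τ) (h2 : τ < t) (i : Fin N) :
    (|corr A f (u + (t - τ) • d) i| = τ →
      (Aᵀ *ᵥ (A *ᵥ d)) i * τ = corr A f (u + (t - τ) • d) i) ∧
    ((u + (t - τ) • d) i = 0 → d i = 0) := by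
  rw [corr_add_smul]
  refine interior_optimality h.nonneg h1 h2 fun s hs hs' => ?_
  have := h.isKKT (h.nonneg.trans_lt hs) hs.le hs' i
  rwa [corr_add_smul] at this

theorem IsKKT.mem_equicorrelationSet {t : ℝ} {u : Fin N → ℝ} (hu : IsKKT A f t u) (ht : 0 ≤ t)
    {i : Fin N} (hi : u i ≠ 0) : i ∈ equicorrelationSet A f t u := by
  rw [Lasso.mem_equicorrelationSet]
  rcases lt_or_gt_of_ne hi with h | h
  · rw [(hu i).2.2 h, abs_neg, abs_of_nonneg ht]
  · rw [(hu i).2.1 h, abs_of_nonneg ht]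

theorem IsStep.mem_feasible_interior {t t' τ : ℝ} {u d u' : Fin N → ℝ} (h : IsStep A f t u d t' u')
    (h1 : t' < τ) (h2 : τ < t) : d ∈ feasible A f τ (u + (t - τ) • d) := by
  have hτ := h.nonneg.trans_lt h1
  refine ⟨fun i hi => ?_, fun i hi => ?_⟩
  · refine (h.interior h1 h2 i).2 ?_
    by_contra hne
    exact hi ((h.isKKT hτ h1.le h2.le).mem_equicorrelationSet hτ.le hne)
  · rw [(h.interior h1 h2 i).2 (by simpa [activeSet] using hi.2), zero_mul]

theorem IsStep.subgrad_interior {t t' τ : ℝ} {u d u' : Fin N → ℝ} (h : IsStep A f t u d t' u')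
    (h1 : t' < τ) (h2 : τ < t) (i : Fin N) (hi : i ∈ equicorrelationSet A f τ (u + (t - τ) • d)) :
    (Aᵀ *ᵥ (A *ᵥ d)) i = subgrad A f τ (u + (t - τ) • d) i := by
  rw [mem_equicorrelationSet] at hi
  rw [subgrad_apply, ← (h.interior h1 h2 i).1 hi, mul_div_cancel_right₀ _ (h.nonneg.trans_lt h1).ne']

/-- The direction of a step solves the least squares problem in the interior of the step, too. -/
theorem IsStep.direction_interior {t t' τ : ℝ} {u d u' : Fin N → ℝ} (h : IsStep A f t u d t' u')
    (h1 : t' < τ) (h2 : τ < t) :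
    d ∈ argminOn l2sq (directions A f τ (u + (t - τ) • d)) := by
  have hτ := h.nonneg.trans_lt h1
  have ht := h.pos
  have hiff := mem_directions_iff (h.mem_feasible_interior h1 h2) (h.subgrad_interior h1 h2)
  refine ⟨(hiff d).2 ⟨h.mem_feasible_interior h1 h2, rfl⟩, fun y hy => ?_⟩
  obtain ⟨hy, hyd⟩ := (hiff y).1 hy
  have hd := h.direction.1.1
  have hcorr : ∀ i, i ∈ equicorrelationSet A f τ (u + (t - τ) • d) →
      corr A f u i = (Aᵀ *ᵥ (A *ᵥ d)) i * t ∧ |(Aᵀ *ᵥ (A *ᵥ d)) i| = 1 := by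
    intro i hi
    rw [mem_equicorrelationSet] at hi
    have e1 := (h.interior h1 h2 i).1 hi
    constructor
    · rw [corr_add_smul] at e1; linarith
    · rw [← e1, abs_mul, abs_of_pos hτ] at hi
      exact mul_right_cancel₀ hτ.ne' (hi.trans (one_mul τ).symm)
  -- A competitor `y` at `τ` may be infeasible at `t`, but a short move from `d` towards it is
  -- feasible: strict sign constraints persist, and where `d i = 0` on an inactive index, `y`
  -- vanishes or obeys the same constraint at `τ`. The move keeps the image `A d`, so minimality of
  -- `d` at `t` transfers.
  have hev : ∀ᶠ e in nhdsWithin (0 : ℝ) (Set.Ioi 0), d + e • (y - d) ∈ feasible A f t u := by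
    have : ∀ᶠ e in nhdsWithin (0 : ℝ) (Set.Ioi 0), ∀ i,
        (i ∉ equicorrelationSet A f t u → (d + e • (y - d)) i = 0) ∧
        (i ∈ equicorrelationSet A f t u \ activeSet u →
          0 ≤ (d + e • (y - d)) i * subgrad A f t u i) := by
      refine Filter.eventually_all.2 fun i => Filter.Eventually.and ?_ ?_
      · refine Filter.Eventually.of_forall fun e hi => ?_
        have hi' : i ∉ equicorrelationSet A f τ (u + (t - τ) • d) := by
          intro hi'
          obtain ⟨e1, e2⟩ := hcorr i hi'
          exact hi (by rw [mem_equicorrelationSet, e1, abs_mul, e2, abs_of_pos ht, one_mul])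
        simp [hd.1 i hi, hy.1 i hi']
      · rcases (em (i ∈ equicorrelationSet A f t u \ activeSet u)) with hi | hi
        swap
        · exact Filter.Eventually.of_forall fun e hi' => absurd hi' hi
        rcases (hd.2 i hi).eq_or_lt with h0 | h0
        · have hp : subgrad A f t u i ≠ 0 := by
            have := hi.1
            rw [mem_equicorrelationSet] at this
            rw [subgrad_apply]
            exact div_ne_zero (abs_pos.1 (this ▸ ht)) ht.ne'
          have hdi : d i = 0 := (mul_eq_zero.1 h0.symm).resolve_right hp
          filter_upwards [self_mem_nhdsWithin] with e he _
          have he : 0 < e := he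
          by_cases hiE : i ∈ equicorrelationSet A f τ (u + (t - τ) • d)
          · have hact : i ∉ activeSet (u + (t - τ) • d) := by
              have : u i = 0 := by simpa [activeSet] using hi.2
              simp [activeSet, this, hdi]
            have h3 := hy.2 i ⟨hiE, hact⟩
            rw [← h.subgrad_interior h1 h2 i hiE] at h3
            rw [subgrad_apply, (hcorr i hiE).1, mul_div_cancel_right₀ _ ht.ne']
            simp only [Pi.add_apply, Pi.smul_apply, Pi.sub_apply, hdi, smul_eq_mul]
            nlinarith
          · simp [hdi, hy.1 i hiE]
        · have hc : Continuous fun e : ℝ => (d + e • (y - d)) i * subgrad A f t u i := by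
            simp only [Pi.add_apply, Pi.smul_apply]; fun_prop
          refine nhdsWithin_le_nhds (((hc.tendsto 0).eventually (lt_mem_nhds ?_)).mono
            fun e he _ => le_of_lt he)
          simpa using h0
    filter_upwards [this] with e he
    exact ⟨fun i => (he i).1, fun i => (he i).2⟩
  obtain ⟨e, he, he0, he1⟩ := (hev.and (Ioo_mem_nhdsGT one_pos)).exists
  have hmem : d + e • (y - d) ∈ directions A f t u := by
    refine ⟨he, fun z hz => ?_⟩
    have : A *ᵥ (d + e • (y - d)) = A *ᵥ d := by
      rw [Matrix.mulVec_add, Matrix.mulVec_smul, Matrix.mulVec_sub, hyd]; simp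
    dsimp only
    rw [this]
    exact h.direction.1.2 z hz
  have h3 := (h.direction.2 _ hmem).trans (l2sq_combo_le d y he0.le he1.le)
  nlinarith

variable (A f) in
/-- The correlations at `(t, u)` and at `(s, v)` attain their extreme values at the same indices
and with the same signs. -/
def SameSides (t : ℝ) (u : Fin N → ℝ) (s : ℝ) (v : Fin N → ℝ) : Prop :=
  ∀ i, (corr A f u i = t ↔ corr A f v i = s) ∧ (corr A f u i = -t ↔ corr A f v i = -s)

theorem SameSides.symm {t s : ℝ} {u v : Fin N → ℝ} (h : SameSides A f t u s v) :
    SameSides A f s v t u := fun i => ⟨(h i).1.symm, (h i).2.symm⟩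

theorem SameSides.trans {t s r : ℝ} {u v w : Fin N → ℝ} (h : SameSides A f t u s v)
    (h' : SameSides A f s v r w) : SameSides A f t u r w :=
  fun i => ⟨(h i).1.trans (h' i).1, (h i).2.trans (h' i).2⟩

theorem SameSides.equicorrelationSet_eq {t s : ℝ} {u v : Fin N → ℝ} (h : SameSides A f t u s v)
    (ht : 0 < t) (hs : 0 < s) : equicorrelationSet A f t u = equicorrelationSet A f s v := by
  ext i
  rw [mem_equicorrelationSet, mem_equicorrelationSet, abs_eq ht.le, abs_eq hs.le, (h i).1, (h i).2]

theorem SameSides.subgrad_eq {t s : ℝ} {u v : Fin N → ℝ} (h : SameSides A f t u s v)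
    (ht : 0 < t) (hs : 0 < s) {i : Fin N} (hi : i ∈ equicorrelationSet A f t u) :
    subgrad A f t u i = subgrad A f s v i := by
  rw [mem_equicorrelationSet, abs_eq ht.le] at hi
  rw [subgrad_apply, subgrad_apply]
  rcases hi with hi | hi
  · rw [hi, (h i).1.1 hi, div_self ht.ne', div_self hs.ne']
  · rw [hi, (h i).2.1 hi, neg_div, neg_div, div_self ht.ne', div_self hs.ne']

theorem SameSides.feasible_subset {t s : ℝ} {u v : Fin N → ℝ} (h : SameSides A f t u s v)
    (ht : 0 < t) (hs : 0 < s) (ha : activeSet u ⊆ activeSet v) :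
    feasible A f t u ⊆ feasible A f s v := by
  intro d hd
  have hE := h.equicorrelationSet_eq ht hs
  refine ⟨fun i hi => hd.1 i (hE ▸ hi), fun i hi => ?_⟩
  have hi' : i ∈ equicorrelationSet A f t u := hE ▸ hi.1
  rw [← h.subgrad_eq ht hs hi']
  exact hd.2 i ⟨hi', fun hu => hi.2 (ha hu)⟩

/-- `d₁ - d₂` is supported on the common equicorrelation set, where `Aᵀ A (d₁ - d₂)` vanishes.
Active sets play no role here. -/
theorem SameSides.mulVec_eq {t₁ t₂ t₁' t₂' τ₁ τ₂ : ℝ} {u₁ u₂ d₁ d₂ u₁' u₂' : Fin N → ℝ}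
    (h₁ : IsStep A f t₁ u₁ d₁ t₁' u₁') (hl₁ : t₁' < τ₁) (hr₁ : τ₁ < t₁)
    (h₂ : IsStep A f t₂ u₂ d₂ t₂' u₂') (hl₂ : t₂' < τ₂) (hr₂ : τ₂ < t₂)
    (h : SameSides A f τ₁ (u₁ + (t₁ - τ₁) • d₁) τ₂ (u₂ + (t₂ - τ₂) • d₂)) :
    A *ᵥ d₁ = A *ᵥ d₂ := by
  have hτ₁ := h₁.nonneg.trans_lt hl₁
  have hτ₂ := h₂.nonneg.trans_lt hl₂
  have hE := h.equicorrelationSet_eq hτ₁ hτ₂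
  have h0 : l2sq (A *ᵥ (d₁ - d₂)) = 0 := by
    rw [l2sq_mulVec]
    refine Finset.sum_eq_zero fun i _ => ?_
    by_cases hi : i ∈ equicorrelationSet A f τ₁ (u₁ + (t₁ - τ₁) • d₁)
    · rw [Matrix.mulVec_sub, Matrix.mulVec_sub, Pi.sub_apply (Aᵀ *ᵥ (A *ᵥ d₁)),
        h₁.subgrad_interior hl₁ hr₁ i hi, h₂.subgrad_interior hl₂ hr₂ i (hE ▸ hi),
        h.subgrad_eq hτ₁ hτ₂ hi, sub_self, mul_zero]
    · rw [Pi.sub_apply, (h₁.mem_feasible_interior hl₁ hr₁).1 i hi,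
        (h₂.mem_feasible_interior hl₂ hr₂).1 i (hE ▸ hi), sub_self, zero_mul]
  rwa [l2sq_eq_zero, Matrix.mulVec_sub, sub_eq_zero] at h0

/-- The direction of a step is determined by the signs of the extreme correlations and the active
set in its interior. -/
theorem SameSides.direction_eq {t₁ t₂ t₁' t₂' τ₁ τ₂ : ℝ} {u₁ u₂ d₁ d₂ u₁' u₂' : Fin N → ℝ}
    (h₁ : IsStep A f t₁ u₁ d₁ t₁' u₁') (hl₁ : t₁' < τ₁) (hr₁ : τ₁ < t₁)
    (h₂ : IsStep A f t₂ u₂ d₂ t₂' u₂') (hl₂ : t₂' < τ₂) (hr₂ : τ₂ < t₂)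
    (h : SameSides A f τ₁ (u₁ + (t₁ - τ₁) • d₁) τ₂ (u₂ + (t₂ - τ₂) • d₂))
    (ha : activeSet (u₁ + (t₁ - τ₁) • d₁) = activeSet (u₂ + (t₂ - τ₂) • d₂)) : d₁ = d₂ := by
  have hτ₁ := h₁.nonneg.trans_lt hl₁
  have hτ₂ := h₂.nonneg.trans_lt hl₂
  have hD : directions A f τ₁ (u₁ + (t₁ - τ₁) • d₁) = directions A f τ₂ (u₂ + (t₂ - τ₂) • d₂) := by
    ext y
    rw [mem_directions_iff (h₁.mem_feasible_interior hl₁ hr₁) (h₁.subgrad_interior hl₁ hr₁),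
      mem_directions_iff (h₂.mem_feasible_interior hl₂ hr₂) (h₂.subgrad_interior hl₂ hr₂),
      h.mulVec_eq h₁ hl₁ hr₁ h₂ hl₂ hr₂,
      (h.feasible_subset hτ₁ hτ₂ ha.le).antisymm (h.symm.feasible_subset hτ₂ hτ₁ ha.ge)]
  refine eq_of_mem_argminOn_l2sq (convex_directions A f _ _) (h₁.direction_interior hl₁ hr₁) ?_
  rw [hD]
  exact h₂.direction_interior hl₂ hr₂

/-- The norms of the directions increase as long as the extreme correlations keep their signs. -/
theorem IsStep.l2sq_lt {t₀ t₁ t₂ τ₁ τ₂ : ℝ} {u₀ u₁ u₂ d₁ d₂ : Fin N → ℝ}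
    (h₁ : IsStep A f t₀ u₀ d₁ t₁ u₁) (hl₁ : t₁ < τ₁) (hr₁ : τ₁ < t₀)
    (h₂ : IsStep A f t₁ u₁ d₂ t₂ u₂) (hl₂ : t₂ < τ₂) (hr₂ : τ₂ < t₁)
    (hs₁ : SameSides A f τ₁ (u₀ + (t₀ - τ₁) • d₁) t₁ u₁)
    (hs₂ : SameSides A f t₁ u₁ τ₂ (u₁ + (t₁ - τ₂) • d₂)) : l2sq d₁ < l2sq d₂ := by
  have hτ₁ := h₁.nonneg.trans_lt hl₁
  have hu₁ : u₁ = u₀ + (t₀ - τ₁) • d₁ + (τ₁ - t₁) • d₁ := by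
    rw [h₁.iterate, add_assoc, ← add_smul]; congr 2; ring
  have hact : activeSet u₁ ⊆ activeSet (u₀ + (t₀ - τ₁) • d₁) := by
    intro i hi h0
    refine hi ?_
    rw [hu₁, Pi.add_apply, h0, Pi.smul_apply, (h₁.interior hl₁ hr₁ i).2 h0, smul_zero, add_zero]
  -- The active set can only shrink at the end of a step, which adds sign constraints; so the next
  -- direction already competed inside the previous step.
  have hmem : d₂ ∈ directions A f τ₁ (u₀ + (t₀ - τ₁) • d₁) := by
    rw [mem_directions_iff (h₁.mem_feasible_interior hl₁ hr₁) (h₁.subgrad_interior hl₁ hr₁)]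
    exact ⟨hs₁.symm.feasible_subset h₂.pos hτ₁ hact h₂.direction.1.1,
      ((hs₁.trans hs₂).mulVec_eq h₁ hl₁ hr₁ h₂ hl₂ hr₂).symm⟩
  have hmin := h₁.direction_interior hl₁ hr₁
  refine lt_of_le_of_ne (hmin.2 _ hmem) fun heq => ?_
  obtain rfl : d₁ = d₂ := eq_of_mem_argminOn_l2sq (convex_directions A f _ _) hmin
    ⟨hmem, fun y hy => heq ▸ hmin.2 y hy⟩
  -- With equal directions the two segments join into one, so the first step could have continued to
  -- `t₂`.
  refine absurd (h₁.parameter.2 ⟨h₂.nonneg, h₂.le.trans h₁.le, fun τ hτ => ?_⟩) h₂.lt.not_ge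
  rcases le_total t₁ τ with h | h
  · exact h₁.parameter.1.2.2 τ ⟨h, hτ.2⟩
  · have := h₂.parameter.1.2.2 τ ⟨hτ.1, h⟩
    rw [h₁.iterate, add_assoc, ← add_smul] at this
    convert this using 3; ring

/-- If the extreme correlations have the same signs at two parameters, then they have these signs
at all parameters in between. -/
theorem SameSides.of_between {τ₁ τ₂ τ : ℝ} {v₁ v₂ v : Fin N → ℝ} (hlt : τ₂ < τ₁)
    (hv₁ : IsKKT A f τ₁ v₁) (hv₂ : IsKKT A f τ₂ v₂) (h : SameSides A f τ₁ v₁ τ₂ v₂)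
    (hl : τ₂ ≤ τ) (hr : τ ≤ τ₁) (hv : IsKKT A f τ v) : SameSides A f τ₁ v₁ τ v := by
  obtain ⟨e, he0, he1, rfl⟩ : ∃ e, 0 ≤ e ∧ e ≤ 1 ∧ τ = (1 - e) * τ₂ + e * τ₁ := by
    have hpos : 0 < τ₁ - τ₂ := by linarith
    refine ⟨(τ - τ₂) / (τ₁ - τ₂), div_nonneg (by linarith) hpos.le,
      (div_le_one hpos).2 (by linarith), ?_⟩
    field_simp
    ring
  have hcorr : ∀ i, corr A f (v₂ + e • (v₁ - v₂)) i
      = (1 - e) * corr A f v₂ i + e * corr A f v₁ i := by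
    intro i
    have := congrFun (corr_add A f v₂ (v₁ - v₂)) i
    rw [add_sub_cancel, Pi.sub_apply] at this
    rw [corr_add_smul, this]; ring
  have he1' : 0 ≤ 1 - e := by linarith
  -- Equal signs make the convex combination a solution at `τ`. Uniqueness of the image then shows
  -- that the correlations of the arbitrary solution `v` are interpolated as well.
  have hz : IsKKT A f ((1 - e) * τ₂ + e * τ₁) (v₂ + e • (v₁ - v₂)) := by
    intro i
    rw [hcorr]
    obtain ⟨a1, p1, n1⟩ := hv₁ i
    obtain ⟨a2, p2, n2⟩ := hv₂ i
    have hui : (v₂ + e • (v₁ - v₂)) i = (1 - e) * v₂ i + e * v₁ i := by simp; ring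
    rw [hui]
    rw [abs_le] at a1 a2 ⊢
    refine ⟨⟨by nlinarith, by nlinarith⟩, fun hi => ?_, fun hi => ?_⟩
    · have : corr A f v₁ i = τ₁ := by
        by_cases h1 : 0 < v₁ i
        · exact p1 h1
        · refine (h i).1.2 (p2 ?_)
          by_contra h2
          nlinarith
      rw [this, (h i).1.1 this]
    · have : corr A f v₁ i = -τ₁ := by
        by_cases h1 : v₁ i < 0
        · exact n1 h1
        · refine (h i).2.2 (n2 ?_)
          by_contra h2
          nlinarith
      rw [this, (h i).2.1 this]; ring
  rw [corr_congr A f (hz.mulVec_eq hv)] at hcorr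
  intro i
  rw [hcorr]
  obtain ⟨a1, -, -⟩ := hv₁ i
  obtain ⟨a2, -, -⟩ := hv₂ i
  rw [abs_le] at a1 a2
  refine ⟨⟨fun hi => by rw [hi, (h i).1.1 hi], fun hi => ?_⟩,
    ⟨fun hi => by rw [hi, (h i).2.1 hi]; ring, fun hi => ?_⟩⟩
  · by_contra hne
    have l1 := lt_of_le_of_ne a1.2 hne
    have l2 := lt_of_le_of_ne a2.2 (mt (h i).1.2 hne)
    rcases he0.eq_or_lt with rfl | he
    · linarith
    · nlinarith
  · by_contra hne
    have l1 := lt_of_le_of_ne a1.1 (Ne.symm hne)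
    have l2 := lt_of_le_of_ne a2.1 (Ne.symm (mt (h i).2.2 hne))
    rcases he0.eq_or_lt with rfl | he
    · linarith
    · nlinarith

/-- There is no infinite sequence of steps. -/
theorem not_forall_isStep (t : ℕ → ℝ) (u d : ℕ → Fin N → ℝ) :
    ¬ ∀ j, IsStep A f (t j) (u j) (d (j + 1)) (t (j + 1)) (u (j + 1)) := by
  intro h
  have hanti : StrictAnti t := strictAnti_nat_of_succ_lt fun j => (h j).lt
  -- Midpoints, because a pattern determines the direction only in the interior of a step.
  set τ : ℕ → ℝ := fun j => (t j + t (j + 1)) / 2 with hτ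
  have hl : ∀ j, t (j + 1) < τ j := fun j => by simp only [hτ]; linarith [(h j).lt]
  have hr : ∀ j, τ j < t j := fun j => by simp only [hτ]; linarith [(h j).lt]
  have hτpos : ∀ j, 0 < τ j := fun j => (h j).nonneg.trans_lt (hl j)
  set v : ℕ → Fin N → ℝ := fun j => u j + (t j - τ j) • d (j + 1) with hv
  have hKKT : ∀ j, IsKKT A f (τ j) (v j) := fun j => (h j).isKKT (hτpos j) (hl j).le (hr j).le
  have hτanti : StrictAnti τ := strictAnti_nat_of_succ_lt fun j => (hr (j + 1)).trans (hl j)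
  set pattern : ℕ → Set (Fin N) × Set (Fin N) × Set (Fin N) := fun j =>
    ({i | corr A f (v j) i = τ j}, {i | corr A f (v j) i = -τ j}, activeSet (v j)) with hpat
  obtain ⟨j, k, hjk, heq⟩ : ∃ j k, j < k ∧ pattern j = pattern k := by
    obtain ⟨j, k, hne, heq⟩ := Finite.exists_ne_map_eq_of_infinite pattern
    rcases hne.lt_or_gt with hlt | hlt
    exacts [⟨j, k, hlt, heq⟩, ⟨k, j, hlt, heq.symm⟩]
  simp only [hpat, Prod.mk.injEq, Set.ext_iff] at heq
  obtain ⟨e1, e2, e3⟩ := heq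
  have hsame : SameSides A f (τ j) (v j) (τ k) (v k) := fun i => ⟨e1 i, e2 i⟩
  have hdir : d (j + 1) = d (k + 1) :=
    hsame.direction_eq (h j) (hl j) (hr j) (h k) (hl k) (hr k) (Set.ext e3)
  have hbetween : ∀ {s w}, τ k ≤ s → s ≤ τ j → IsKKT A f s w → SameSides A f (τ j) (v j) s w :=
    fun h1 h2 h3 => SameSides.of_between (hτanti hjk) (hKKT j) (hKKT k) hsame h1 h2 h3
  have hstep : ∀ l, j ≤ l → l < k → l2sq (d (l + 1)) < l2sq (d (l + 2)) := by
    intro l hjl hlk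
    have hτk : τ k ≤ τ (l + 1) := hτanti.antitone hlk
    have hτj : τ l ≤ τ j := hτanti.antitone hjl
    have s1 := hbetween (hτanti.antitone hlk.le) hτj (hKKT l)
    have s2 := hbetween (hτk.trans (hr (l + 1)).le) ((hl l).le.trans hτj)
      (h (l + 1)).isKKT_left
    have s3 := hbetween hτk ((hτanti.antitone (Nat.le_succ l)).trans hτj) (hKKT (l + 1))
    exact (h l).l2sq_lt (hl l) (hr l) (h (l + 1)) (hl (l + 1)) (hr (l + 1)) (s1.symm.trans s2)
      (s2.symm.trans s3)
  have hlt : ∀ l, j < l → l ≤ k → l2sq (d (j + 1)) < l2sq (d (l + 1)) := by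
    intro l hjl
    induction l, hjl using Nat.le_induction with
    | base => exact fun hk => hstep j le_rfl hk
    | succ l hl ih => exact fun hk => (ih (by omega)).trans (hstep l (by omega) hk)
  exact (hlt k hjk le_rfl).ne (by rw [hdir])

end

/-! ### The complete execution and its solution path -/

section

variable {m N : ℕ} {A : Matrix (Fin m) (Fin N) ℝ} {f : Fin m → ℝ}

variable (A f) in
/-- The generalized homotopy method reaches the parameter `0` after finitely many steps. -/
theorem exists_isExecution :
    ∃ (K : ℕ) (t : ℕ → ℝ) (u d : ℕ → Fin N → ℝ), IsExecution A f K t u d ∧ t K = 0 := by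
  have hex : ∀ p : ℝ × (Fin N → ℝ) × (Fin N → ℝ), ∃ q : ℝ × (Fin N → ℝ) × (Fin N → ℝ),
      0 < p.1 → IsKKT A f p.1 p.2.1 → IsStep A f p.1 p.2.1 q.2.2 q.1 q.2.1 := by
    intro p
    by_cases h : 0 < p.1 ∧ IsKKT A f p.1 p.2.1
    · obtain ⟨d, t', u', hs⟩ := exists_isStep h.2 h.1
      exact ⟨(t', u', d), fun _ _ => hs⟩
    -- A default value that makes the step function total, so that it can be iterated.
    · exact ⟨p, fun h1 h2 => absurd ⟨h1, h2⟩ h⟩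
  choose g hg using hex
  set x : ℕ → ℝ × (Fin N → ℝ) × (Fin N → ℝ) := fun j => g^[j] (‖Aᵀ *ᵥ f‖, 0, 0) with hx
  have hsucc : ∀ j, x (j + 1) = g (x j) := fun j => Function.iterate_succ_apply' g j _
  have hKKT : ∀ j, (∀ l ≤ j, 0 < (x l).1) → IsKKT A f (x j).1 (x j).2.1 := by
    intro j
    induction j with
    | zero => exact fun _ => isKKT_zero le_rfl
    | succ j ih =>
      intro h
      have hs := hg (x j) (h j (Nat.le_succ j)) (ih fun l hl => h l (hl.trans (Nat.le_succ j)))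
      rw [← hsucc] at hs
      exact hs.isKKT_right (h _ le_rfl)
  have hstep : ∀ j, (∀ l ≤ j, 0 < (x l).1) →
      IsStep A f (x j).1 (x j).2.1 (x (j + 1)).2.2 (x (j + 1)).1 (x (j + 1)).2.1 := by
    intro j h
    rw [hsucc]
    exact hg (x j) (h j le_rfl) (hKKT j h)
  have hfin : ∃ j, ¬ 0 < (x j).1 := by
    by_contra! h
    exact not_forall_isStep (A := A) (f := f) (fun j => (x j).1) (fun j => (x j).2.1)
      (fun j => (x j).2.2) fun j => hstep j fun l _ => h l
  classical
  have hlt : ∀ l < Nat.find hfin, 0 < (x l).1 := fun l hl => not_not.1 (Nat.find_min hfin hl)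
  have hst := fun j (hj : j < Nat.find hfin) => hstep j fun l hl => hlt l (hl.trans_lt hj)
  refine ⟨Nat.find hfin, fun j => (x j).1, fun j => (x j).2.1, fun j => (x j).2.2,
    ⟨rfl, rfl, hst⟩, le_antisymm (not_lt.1 (Nat.find_spec hfin)) ?_⟩
  rcases Nat.eq_zero_or_pos (Nat.find hfin) with h0 | h0
  · rw [h0]; exact norm_nonneg (Aᵀ *ᵥ f)
  · have := (hst (Nat.find hfin - 1) (by omega)).nonneg
    rwa [Nat.sub_add_cancel h0] at this

theorem IsExecution.eq {n K : ℕ} {t t' : ℕ → ℝ} {u d u' d' : ℕ → Fin N → ℝ}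
    (h : IsExecution A f K t u d) (h' : IsExecution A f n t' u' d') {j : ℕ} (hn : j ≤ n)
    (hK : j ≤ K) : t' j = t j ∧ u' j = u j := by
  induction j with
  | zero => exact ⟨h'.parameter_zero.trans h.parameter_zero.symm,
      h'.iterate_zero.trans h.iterate_zero.symm⟩
  | succ j ih =>
    obtain ⟨e1, e2⟩ := ih (by omega) (by omega)
    have s := h.step j hK
    have s' := h'.step j hn
    rw [e1, e2] at s'
    exact (s'.unique s).2

theorem IsExecution.antitone {K : ℕ} {t : ℕ → ℝ} {u d : ℕ → Fin N → ℝ}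
    (h : IsExecution A f K t u d) {k n : ℕ} (hkn : k ≤ n) (hn : n ≤ K) : t n ≤ t k := by
  induction n, hkn using Nat.le_induction with
  | base => exact le_rfl
  | succ n _ ih => exact (h.step n hn).le.trans (ih (by omega))

/-- The path that starts at `0` and runs from `t k` to `t (k + 1)` in direction `d (k + 1)`. -/
noncomputable def path (t : ℕ → ℝ) (d : ℕ → Fin N → ℝ) (n : ℕ) (τ : ℝ) : Fin N → ℝ :=
  ∑ k ∈ Finset.range n, max 0 (min (t k - τ) (t k - t (k + 1))) • d (k + 1)

theorem path_succ (t : ℕ → ℝ) (d : ℕ → Fin N → ℝ) (n : ℕ) (τ : ℝ) : path t d (n + 1) τ =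
    path t d n τ + max 0 (min (t n - τ) (t n - t (n + 1))) • d (n + 1) :=
  Finset.sum_range_succ _ _

theorem continuous_path (t : ℕ → ℝ) (d : ℕ → Fin N → ℝ) (n : ℕ) : Continuous (path t d n) := by
  unfold path; fun_prop

theorem IsExecution.path_eq_iterate {K : ℕ} {t : ℕ → ℝ} {u d : ℕ → Fin N → ℝ}
    (h : IsExecution A f K t u d) {n : ℕ} (hn : n ≤ K) {τ : ℝ} (hτ : τ ≤ t n) :
    path t d n τ = u n := by
  induction n with
  | zero => simp [path, h.iterate_zero]
  | succ n ih =>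
    have hs := h.step n hn
    rw [path_succ, ih (by omega) (hτ.trans hs.le), hs.iterate, min_eq_right (by linarith),
      max_eq_right (by linarith [hs.le])]

theorem IsExecution.path_eq_path {K : ℕ} {t : ℕ → ℝ} {u d : ℕ → Fin N → ℝ}
    (h : IsExecution A f K t u d) {k n : ℕ} (hkn : k ≤ n) (hn : n ≤ K) {τ : ℝ} (hτ : t k ≤ τ) :
    path t d n τ = path t d k τ := by
  induction n, hkn using Nat.le_induction with
  | base => rfl
  | succ n hkn ih =>
    have := h.antitone hkn (by omega)
    rw [path_succ, ih (by omega), max_eq_left (min_le_of_left_le (by linarith)), zero_smul,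
      add_zero]

theorem IsExecution.path_eq {K : ℕ} {t : ℕ → ℝ} {u d : ℕ → Fin N → ℝ}
    (h : IsExecution A f K t u d) {k : ℕ} (hk : k < K) {τ : ℝ} (h1 : t (k + 1) ≤ τ)
    (h2 : τ ≤ t k) : path t d K τ = u k + (t k - τ) • d (k + 1) := by
  rw [h.path_eq_path hk le_rfl h1, path_succ, h.path_eq_iterate hk.le h2,
    min_eq_left (by linarith), max_eq_right (by linarith)]

theorem IsExecution.path_eq_zero {K : ℕ} {t : ℕ → ℝ} {u d : ℕ → Fin N → ℝ}
    (h : IsExecution A f K t u d) {τ : ℝ} (hτ : t 0 ≤ τ) : path t d K τ = 0 := by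
  rw [h.path_eq_path K.zero_le le_rfl hτ]; simp [path]

/-- The limit argument along the constant path also covers `t = 0`, which occurs when `Aᵀ f = 0`. -/
theorem zero_mem_solutionSet {t : ℝ} (ht : ‖Aᵀ *ᵥ f‖ ≤ t) : 0 ∈ solutionSet A f t := by
  refine mem_solutionSet_of_tendsto (w := fun _ => 0) ((norm_nonneg _).trans ht)
    continuous_const ?_
  filter_upwards [self_mem_nhdsWithin] with τ hτ
  exact isKKT_zero (ht.trans (Set.mem_Ioi.1 hτ).le)

theorem IsExecution.path_mem_solutionSet {K : ℕ} {t : ℕ → ℝ} {u d : ℕ → Fin N → ℝ}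
    (h : IsExecution A f K t u d) {τ : ℝ} (hτ : t K ≤ τ) :
    path t d K τ ∈ solutionSet A f τ := by
  by_cases h0 : t 0 ≤ τ
  · rw [h.path_eq_zero h0]
    exact zero_mem_solutionSet (h.parameter_zero ▸ h0)
  · classical
    have hex : ∃ n, t n ≤ τ := ⟨K, hτ⟩
    obtain ⟨k, hk⟩ : ∃ k, Nat.find hex = k + 1 :=
      Nat.exists_eq_succ_of_ne_zero fun h1 => h0 (h1 ▸ Nat.find_spec hex)
    have hkK : k < K := by have := Nat.find_min' hex hτ; omega
    have h1 : t (k + 1) ≤ τ := hk ▸ Nat.find_spec hex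
    have h2 : τ ≤ t k := (not_le.1 (Nat.find_min hex (m := k) (by omega))).le
    rw [h.path_eq hkK h1 h2]
    exact (h.step k hkK).parameter.1.2.2 τ ⟨h1, h2⟩

theorem IsExecution.isInterpolation {K : ℕ} {t : ℕ → ℝ} {u d : ℕ → Fin N → ℝ}
    (h : IsExecution A f K t u d) : IsInterpolation K t u fun τ => path t d K τ := by
  refine ⟨fun τ hτ => h.path_eq_zero hτ, fun k hk τ hτ => ?_⟩
  have hs := h.step k hk
  have hne : t k - t (k + 1) ≠ 0 := (sub_pos.2 hs.lt).ne'
  dsimp only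
  rw [h.path_eq hk hτ.1 hτ.2.le, hs.iterate]
  ext i
  simp only [Pi.add_apply, Pi.smul_apply, smul_eq_mul]
  field_simp
  ring

theorem IsExecution.isPiecewiseLinear {K : ℕ} {t : ℕ → ℝ} {u d : ℕ → Fin N → ℝ}
    (h : IsExecution A f K t u d) (hK : t K = 0) :
    IsPiecewiseLinear fun τ => path t d K τ := by
  have hnn : ∀ i : Fin (K + 1), 0 ≤ t (K - i) := fun i => hK ▸ h.antitone (Nat.sub_le _ _) le_rfl
  -- The parameters decrease along the execution, so the breakpoints are listed in reverse.
  refine ⟨K, fun i => ⟨t (K - i), hnn i⟩, NNReal.eq hK, ?_, fun i => ?_, 0, 0,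
    fun τ hτ => ?_⟩
  · refine Fin.strictMono_iff_lt_succ.2 fun i => ?_
    have hs := (h.step (K - (i + 1)) (by omega)).lt
    rw [show K - (i + 1) + 1 = K - i by omega] at hs
    exact_mod_cast hs
  · refine ⟨u (K - (i + 1)) + t (K - (i + 1)) • d (K - (i + 1) + 1), -d (K - (i + 1) + 1),
      fun τ hτ => ?_⟩
    have h1 : t (K - i) ≤ τ := hτ.1
    have h2 : (τ : ℝ) < t (K - (i + 1)) := hτ.2
    dsimp only
    rw [h.path_eq (k := K - (i + 1)) (by omega)
      (by rwa [show K - (i + 1) + 1 = K - i by omega]) h2.le, sub_smul, smul_neg]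
    abel
  · have h1 : t (K - K) ≤ τ := hτ
    rw [Nat.sub_self] at h1
    simp [h.path_eq_zero h1]

end

end Lasso

theorem theorem4p2 {m N : ℕ} (A : Matrix (Fin m) (Fin N) ℝ) (f : Fin m → ℝ) :
    ∃ (K : ℕ) (t : ℕ → ℝ) (u d : ℕ → Fin N → ℝ),
      Lasso.IsExecution A f K t u d ∧ t K = 0 ∧ (∀ j < K, t (j + 1) < t j) ∧
      (∀ (n : ℕ) (t' : ℕ → ℝ) (u' d' : ℕ → Fin N → ℝ), Lasso.IsExecution A f n t' u' d' →
        n ≤ K ∧ (∀ j ≤ n, t' j = t j ∧ u' j = u j) ∧ ∀ j < n, d' (j + 1) = d (j + 1)) ∧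
      ∃ w : ℝ≥0 → Fin N → ℝ,
        Lasso.IsInterpolation K t u w ∧
        Lasso.IsPiecewiseLinear w ∧
        Continuous w ∧
        (∀ τ : ℝ≥0, 0 < τ → w τ ∈ Lasso.argminOn (Lasso.energy A f τ) Set.univ) ∧
        w 0 ∈ Lasso.argminOn Lasso.l1 {v | Aᵀ *ᵥ (A *ᵥ v - f) = 0} := by
  obtain ⟨K, t, u, d, h, hK⟩ := Lasso.exists_isExecution A f
  refine ⟨K, t, u, d, h, hK, fun j hj => (h.step j hj).lt, fun n t' u' d' h' => ?_,
    fun τ => Lasso.path t d K τ, h.isInterpolation, h.isPiecewiseLinear hK,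
    (Lasso.continuous_path t d K).comp NNReal.continuous_coe, fun τ hτ => ?_, ?_⟩
  -- A longer execution would have to make a step from the parameter `0`.
  · have hn : n ≤ K := by
      by_contra! hlt
      exact (h'.step K hlt).ne_zero ((h.eq h' hlt.le le_rfl).1.trans hK)
    refine ⟨hn, fun j hj => h.eq h' hj (hj.trans hn), fun j hj => ?_⟩
    have s := h.step j (hj.trans_le hn)
    have s' := h'.step j hj
    obtain ⟨e1, e2⟩ := h.eq h' hj.le (hj.le.trans hn)
    rw [e1, e2] at s'
    exact (s'.unique s).1
  · exact (h.path_mem_solutionSet (hK ▸ τ.2)).1 (by exact_mod_cast hτ)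
  · exact (h.path_mem_solutionSet hK.le).2 rfl
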